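/- **Setting (quantum multi-armed bandit, bounded values).** Let $\Omega$ be a finite sample space and $V\subset\mathbb R$ a finite set; the oracle register has basis states $|\omega\rangle|v\rangle$ with $\omega\in\Omega$, $v\in V$, one of which is denoted $|0\rangle$. There are $n\ge 1$ arms. Arm $i$ is given by a probability distribution $P_i$ on $\Omega$, a reward $y^i:\Omega\to V$ with values in $[0,1]$ wherever $P_i(\omega)>0$ (bounded value assumption), and a unitary $\mathcal O_i$ with $\mathcal O_i|0\rangle=\sum_{\omega}\sqrt{P_i(\omega)}\,|\omega\rangle|y^i(\omega)\rangle$. Write $\mu(i)=\sum_\omega P_i(\omega)y^i(\omega)$. In each of $T$ rounds the learner plays one arm, which allows at most one use of its $\mathcal O_i$ or $\mathcal O_i^\dagger$; if arm $x_t$ is played in round $t$, the regret is $R(T)=\sum_{t=1}^T\bigl(\max_j\mu(j)-\mu(x_t)\bigr)$. **QMC.** A Quantum Monte Carlo method with constant $C_1$ is a family of quantum query algorithms $\mathrm{QMC}_1(\cdot,\epsilon,\delta)$, for $\epsilon>0$ and $0<\delta<1$, not depending on the arm, which makes at most $\frac{C_1}{\epsilon}\ln\frac1\delta$ queries to $\mathcal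 O$ and $\mathcal O^\dagger$ and, for every oracle $\mathcal O$ that encodes a $[0,1]$-valued reward with mean $\mu$, returns $\hat y$ with $\Pr(|\hat y-\mu|\ge\epsilon)\le\delta$. **Algorithm $\mathrm{QUCB}_1(\delta)$.** For $i=1,\dots,n$: set $r_i=1$, play arm $i$ for $N_i=\bigl\lceil\frac{C_1}{r_i}\ln\frac1\delta\bigr\rceil$ rounds, and let $\hat\mu(i)$ be the output of $\mathrm{QMC}_1(\mathcal O_i,r_i,\delta)$. Then, in each further stage, choose $i_s\in\arg\max_i(\hat\mu(i)+r_i)$ (ties broken arbitrarily), replace $r_{i_s}$ by $r_{i_s}/2$, play $i_s$ for $N_{i_s}=\bigl\lceil\frac{C_1}{r_{i_s}}\ln\frac1\delta\bigr\rceil$ rounds, and replace $\hat\mu(i_s)$ by the output of a fresh run of $\mathrm{QMC}_1(\mathcal O_{i_s},r_{i_s},\delta)$. The algorithm stops, if necessary in the middle of a stage, after $T$ rounds. **Statement.** There is a universal constant $C_1>1$ such that, for every oracle register, a Quantum Monte Carlo method with constant $C_1$ exists. Moreover, for every $C_1>1$ and every Quantum Monte Carlo method with constant $C_1$ used as subroutine,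 for all $n\ge1$, $T\ge2$, all arms as above and every way of breaking ties, $\mathrm{QUCB}_1(\delta)$ with $\delta=\frac1T$ satisfies $$\mathbb E[R(T)]\le\bigl(8(n-1)C_1+1\bigr)\log_2T ,$$ and $\mathbb E[R(T)]\le K\,n\ln T$ for a constant $K>0$ that depends only on $C_1$; that is, $\mathbb E[R(T)]=O(n\log T)$. -/

import Mathlib

open scoped ENNReal Matrix Kronecker

noncomputable section

namespace QBandit

/-! ### Quantum programs with access to an oracle -/

/-- The squared Euclidean norm of a (possibly unnormalized) state vector. -/
def sqNorm {S : Type} [Fintype S] (ψ : S → ℂ) : ℝ := ∑ s, ‖ψ s‖ ^ 2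

/-- A quantum program on an oracle register with basis `X` and a workspace with basis `W`.
Its elementary steps are: stop with a real output; apply a fixed unitary; query the oracle
`O` (`adjoint = false`) or its inverse `O†` (`adjoint = true`) once on the oracle register;
perform a quantum measurement with measurement operators `M₁, …, M_m`, `∑ M_j† M_j = 1`
(the POVM elements are `M_j† M_j`), and continue depending on the observed outcome. -/
inductive Program (X W : Type) [Fintype X] [DecidableEq X] [Fintype W] [DecidableEq W] : Type
  | output (y : ℝ) : Program X W
  | unitary (U : Matrix.unitaryGroup (X × W) ℂ) (next : Program X W) : Program X W
  | query (adjoint : Bool) (next : Program X W) : Program X W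
  | measure (m : ℕ) (M : Fin m → Matrix (X × W) (X × W) ℂ)
      (hM : ∑ j, (M j)ᴴ * M j = 1) (next : Fin m → Program X W) : Program X W

namespace Program

variable {X W : Type} [Fintype X] [DecidableEq X] [Fintype W] [DecidableEq W]

/-- The number of oracle queries of a program, in the worst case over measurement outcomes. -/
def queries : Program X W → ℕ
  | output _ => 0
  | unitary _ next => next.queries
  | query _ next => next.queries + 1
  | measure _ _ _ next => Finset.univ.sup fun j => (next j).queries

/-- The oracle `O`, or its inverse, acting on the oracle register. -/
def oracleStep (O : Matrix.unitaryGroup X ℂ) (adjoint : Bool) : Matrix (X × W) (X × W) ℂ :=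
  (if adjoint then (O : Matrix X X ℂ)ᴴ else (O : Matrix X X ℂ)) ⊗ₖ (1 : Matrix W W ℂ)

/-- `p.weight O ψ y` is the Born weight with which the program `p`, started in the state `ψ`
with oracle `O`, outputs the number `y`. Post-measurement states are left unnormalized, so that
the squared norm at a leaf is the probability of the branch leading to it. -/
def weight (O : Matrix.unitaryGroup X ℂ) : Program X W → (X × W → ℂ) → ℝ → ℝ≥0∞
  | output y₀, ψ, y => if y = y₀ then ENNReal.ofReal (sqNorm ψ) else 0
  | unitary U next, ψ, y => next.weight O ((U : Matrix (X × W) (X × W) ℂ) *ᵥ ψ) y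
  | query b next, ψ, y => next.weight O (oracleStep O b *ᵥ ψ) y
  | measure _ M _ next, ψ, y => ∑ j, (next j).weight O (M j *ᵥ ψ) y

end Program

theorem sqNorm_nonneg {S : Type} [Fintype S] (ψ : S → ℂ) : 0 ≤ sqNorm ψ :=
  Finset.sum_nonneg fun _ _ => sq_nonneg _

theorem ofReal_sqNorm {S : Type} [Fintype S] (ψ : S → ℂ) :
    ((sqNorm ψ : ℝ) : ℂ) = star ψ ⬝ᵥ ψ := by
  simp only [sqNorm, dotProduct, Pi.star_apply, Complex.ofReal_sum]
  refine Finset.sum_congr rfl fun s _ => ?_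
  rw [RCLike.star_def, Complex.conj_mul']
  push_cast
  rfl

/-- A quantum measurement preserves total probability. -/
theorem sum_sqNorm_mulVec {S J : Type} [Fintype S] [DecidableEq S] [Fintype J]
    (M : J → Matrix S S ℂ) (hM : ∑ j, (M j)ᴴ * M j = 1) (ψ : S → ℂ) :
    ∑ j, sqNorm (M j *ᵥ ψ) = sqNorm ψ := by
  have h : ((∑ j, sqNorm (M j *ᵥ ψ) : ℝ) : ℂ) = ((sqNorm ψ : ℝ) : ℂ) := by
    rw [Complex.ofReal_sum]
    simp only [ofReal_sqNorm]
    have h1 : ∀ j, star (M j *ᵥ ψ) ⬝ᵥ (M j *ᵥ ψ) = star ψ ⬝ᵥ (((M j)ᴴ * M j) *ᵥ ψ) := by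
      intro j
      rw [Matrix.star_mulVec, ← Matrix.dotProduct_mulVec, Matrix.mulVec_mulVec]
    simp only [h1]
    rw [← dotProduct_sum, ← Matrix.sum_mulVec, hM, Matrix.one_mulVec]
  exact_mod_cast h

theorem sqNorm_mulVec {S : Type} [Fintype S] [DecidableEq S]
    (U : Matrix S S ℂ) (hU : Uᴴ * U = 1) (ψ : S → ℂ) : sqNorm (U *ᵥ ψ) = sqNorm ψ := by
  simpa using sum_sqNorm_mulVec (J := Unit) (fun _ => U) (by simpa using hU) ψ

namespace Program

variable {X W : Type} [Fintype X] [DecidableEq X] [Fintype W] [DecidableEq W]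

theorem oracleStep_unitary (O : Matrix.unitaryGroup X ℂ) (b : Bool) :
    (oracleStep (W := W) O b)ᴴ * oracleStep O b = 1 := by
  have h1 : (O : Matrix X X ℂ)ᴴ * (O : Matrix X X ℂ) = 1 := Matrix.UnitaryGroup.star_mul_self O
  have h2 : (O : Matrix X X ℂ) * (O : Matrix X X ℂ)ᴴ = 1 := mul_eq_one_comm.mp h1
  unfold oracleStep
  rw [Matrix.conjTranspose_kronecker, ← Matrix.mul_kronecker_mul]
  cases b <;> simp [h1, h2]

theorem tsum_weight (O : Matrix.unitaryGroup X ℂ) (p : Program X W) (ψ : X × W → ℂ) :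
    ∑' y, p.weight O ψ y = ENNReal.ofReal (sqNorm ψ) := by
  induction p generalizing ψ with
  | output y₀ => simp [weight]
  | unitary U next ih =>
    simp only [weight]
    rw [ih, sqNorm_mulVec _ (Matrix.UnitaryGroup.star_mul_self U)]
  | query b next ih =>
    simp only [weight]
    rw [ih, sqNorm_mulVec _ (oracleStep_unitary O b)]
  | measure m M hM next ih =>
    simp only [weight]
    rw [Summable.tsum_finsetSum fun _ _ => ENNReal.summable]
    simp only [ih]
    rw [← ENNReal.ofReal_sum_of_nonneg fun _ _ => sqNorm_nonneg _, sum_sqNorm_mulVec M hM]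

end Program

/-- A quantum query algorithm for oracles acting on the register `X`: a finite-dimensional
workspace, the basis state in which the workspace starts, and a program. -/
structure QueryAlgorithm (X : Type) [Fintype X] [DecidableEq X] where
  W : Type
  [fintypeW : Fintype W]
  [decEqW : DecidableEq W]
  w₀ : W
  program : Program X W

attribute [instance] QueryAlgorithm.fintypeW QueryAlgorithm.decEqW

namespace QueryAlgorithm

variable {X : Type} [Fintype X] [DecidableEq X]

/-- The maximal number of queries to `O` and `O†`. -/
def queries (A : QueryAlgorithm X) : ℕ := A.program.queries

/-- The law of the output of `A` when it is run with the oracle `O` from the basis state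
`|x₀⟩|w₀⟩`. -/
def law (A : QueryAlgorithm X) (x₀ : X) (O : Matrix.unitaryGroup X ℂ) : PMF ℝ :=
  ⟨A.program.weight O (Pi.single (x₀, A.w₀) 1), by
    have h : sqNorm (Pi.single (x₀, A.w₀) 1 : X × A.W → ℂ) = 1 := by
      simp [sqNorm, Pi.single_apply, apply_ite]
    have h2 := Program.tsum_weight O A.program (Pi.single (x₀, A.w₀) 1)
    rw [h, ENNReal.ofReal_one] at h2
    rw [← h2]
    exact ENNReal.summable.hasSum⟩

end QueryAlgorithm

/-! ### Quantum reward oracles -/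

/-- An arm of a quantum bandit. The oracle register has the basis `|ω⟩|v⟩`, with `ω` in the finite
sample space `Ω` and `v` in a finite set `V` of real numbers; `e₀` is the label of the basis state
called `|0⟩`. The arm consists of a probability distribution `P` on `Ω`, a random reward `y`, and a
unitary `O` that encodes them: `O |0⟩ = ∑ ω, √(P ω) |ω⟩|y ω⟩`. (On the rest of the space `O` is
arbitrary.) -/
structure Arm {Ω : Type} [Fintype Ω] [DecidableEq Ω] {V : Finset ℝ} (e₀ : Ω × V) where
  P : PMF Ω
  y : Ω → V
  O : Matrix.unitaryGroup (Ω × V) ℂ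
  encodes : (O : Matrix (Ω × V) (Ω × V) ℂ) *ᵥ Pi.single e₀ 1 =
    ∑ ω, ((Real.sqrt (P ω).toReal : ℝ) : ℂ) • (Pi.single (ω, y ω) 1 : Ω × V → ℂ)

namespace Arm

variable {Ω : Type} [Fintype Ω] [DecidableEq Ω] {V : Finset ℝ} {e₀ : Ω × V}

/-- The mean reward of an arm. -/
def mean (a : Arm e₀) : ℝ := ∑ ω, (a.P ω).toReal * (a.y ω : ℝ)

/-- The bounded value assumption: all rewards lie in `[0, 1]`. -/
def BoundedValue (a : Arm e₀) : Prop := ∀ ω, a.P ω ≠ 0 → (a.y ω : ℝ) ∈ Set.Icc (0 : ℝ) 1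

end Arm

variable {Ω : Type} [Fintype Ω] [DecidableEq Ω] {V : Finset ℝ}

/-- `IsQMC C₁ e₀ QMC`: the family `QMC ε δ` of quantum query algorithms is a Quantum Monte Carlo
method with constant `C₁` for rewards with bounded value, for oracles on the register `Ω × V`.
It makes at most `(C₁ / ε) log (1 / δ)` queries, and on every oracle that encodes a `[0, 1]`-valued
reward its output is within `ε` of the mean, except with probability at most `δ`. -/
def IsQMC (C₁ : ℝ) (e₀ : Ω × V) (QMC : ℝ → ℝ → QueryAlgorithm (Ω × V)) : Prop :=
  ∀ ε δ : ℝ, 0 < ε → 0 < δ → δ < 1 →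
    ((QMC ε δ).queries : ℝ) ≤ C₁ / ε * Real.log (1 / δ) ∧
    ∀ a : Arm e₀, a.BoundedValue →
      ((QMC ε δ).law e₀ a.O).toOuterMeasure {z | ε ≤ |z - a.mean|} ≤ ENNReal.ofReal δ

/-! ### The algorithm `QUCB₁` -/

/-- The data kept by the algorithm: the confidence radii `r_i`, the estimates of the means, and the
list of the arms played so far, one entry for each round. -/
structure State (n : ℕ) where
  radius : Fin n → ℝ
  est : Fin n → ℝ
  played : List (Fin n)

/-- The state before the first round. (The estimates are overwritten by the initialization.) -/
def State.start (n : ℕ) : State n := ⟨fun _ => 1, fun _ => 0, []⟩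

/-- A selection rule picks, in every state, an arm that maximizes the upper confidence bound
`est i + r_i`; ties are broken in an arbitrary way. -/
def IsArgmaxRule {n : ℕ} (sel : State n → Fin n) : Prop :=
  ∀ (s : State n) (i : Fin n), s.est i + s.radius i ≤ s.est (sel s) + s.radius (sel s)

section QUCB

variable (C₁ δ : ℝ) (T : ℕ) {e₀ : Ω × V} (QMC : ℝ → ℝ → QueryAlgorithm (Ω × V))
  {n : ℕ} (arm : Fin n → Arm e₀)

/-- The number of rounds `N = (C₁ / r) log (1 / δ)`, rounded up, of a stage with radius `r`. -/
def stageLength (r : ℝ) : ℕ := ⌈C₁ / r * Real.log (1 / δ)⌉₊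

/-- One stage: unless `T` rounds are over, set `r_i` to `r`, play the arm `i` for `N` rounds, and
run `QMC` from a fresh initial state to replace the estimate for arm `i`. -/
def stage (i : Fin n) (r : ℝ) (s : State n) : PMF (State n) :=
  if T ≤ s.played.length then PMF.pure s
  else ((QMC r δ).law e₀ (arm i).O).map fun z =>
    { radius := Function.update s.radius i r
      est := Function.update s.est i z
      played := s.played ++ List.replicate (stageLength C₁ δ r) i }

/-- The initialization: every arm gets a stage with radius `1`. -/
def initStages : PMF (State n) :=
  (List.finRange n).foldl (fun p i => p.bind (stage C₁ δ T QMC arm i 1)) (PMF.pure (State.start n))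

/-- `m` further stages: in each, the selected arm gets a stage with half its current radius. -/
def mainStages (sel : State n → Fin n) : ℕ → State n → PMF (State n)
  | 0, s => PMF.pure s
  | m + 1, s =>
    (stage C₁ δ T QMC arm (sel s) (s.radius (sel s) / 2) s).bind (mainStages sel m)

/-- The law of the arms that `QUCB₁(δ)` plays in the rounds `1, …, T`. The last stage is cut off
after round `T`. Every stage has at least one round (for `0 < C₁` and `0 < δ < 1`), so that `T`
stages after the initialization suffice to reach round `T`. -/
def qucb (sel : State n → Fin n) : PMF (List (Fin n)) :=
  ((initStages C₁ δ T QMC arm).bind (mainStages C₁ δ T QMC arm sel T)).map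
    fun s => s.played.take T

/-- The cumulative regret of a sequence of arms: the sum of the gaps `max_j μ(j) - μ(i)` over the
arms `i` of the sequence. -/
def regret (l : List (Fin n)) : ℝ := (l.map fun i => (⨆ j, (arm j).mean) - (arm i).mean).sum

/-- The expected cumulative regret `E[R(T)]` of `QUCB₁(δ)`. (The regret is nonnegative.) -/
def expectedRegret (sel : State n → Fin n) : ℝ≥0∞ :=
  ∑' l, qucb C₁ δ T QMC arm sel l * ENNReal.ofReal (regret arm l)

end QUCB

end QBandit

end

open scoped ENNReal Matrix Kronecker

noncomputable section

namespace QBandit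

/-! ### Elementary facts on squared norms -/

/-! Existence of Quantum Monte Carlo is amplitude estimation. Conjugating a reward-controlled
reflection by the oracle gives an involution whose diagonal entry at the initial state is `c = 1 -
2μ`; its product with the reflection about that state is a walk whose orbit satisfies the Chebyshev
recurrence `t (k+2) + t k = 2c t (k+1)` (`orbit_recurrence`). Superposing the orbit over a counter
with a slowly varying window therefore gives an approximate eigenvector, with eigenvalue `c`, of
half the adjacency matrix of a path. Measuring that matrix returns a value whose mean squared
distance to `c` is at most `10 / M ^ 2` after `M` steps, and Chebyshev's inequality gives
`estimate_hitsAtMost`. Repetition with a majority rule reaches every `δ ≤ 1/2`. For `δ` near `1`,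
where `log (1/δ)` allows very few queries, a coarse estimate followed by a random shift suffices.

For the regret, as long as all estimates are accurate, the arm that maximizes the upper confidence
bound has gap at most twice its old radius, hence four times the new one. Stage lengths grow like
`C₁ log T * 2 ^ j`, so the plays of a suboptimal arm cost at most `8 C₁ log T + 3` in total
(`Consistent.count_mul_gap_le`). The played arms and radii after a stage do not depend on its
measurement outcome, so this bound survives a failure in the last stage. In any other stage a
failure has probability at most `1/T` and costs at most `T`, that is, one unit in expectation. An
arm has at most `log₂ T` stages followed by further play, which adds `n log₂ T` (`valueBound`,
`expect_stage_le`). For `T ≥ 32` the factor `ln 2 < 0.7` between `ln T` and `log₂ T` absorbs the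
lower-order terms; for smaller `T` the trivial bound `T` suffices if `n ≥ 2`, and the regret
vanishes if `n = 1`. -/

theorem sqNorm_smul {S : Type} [Fintype S] (c : ℂ) (ψ : S → ℂ) :
    sqNorm (c • ψ) = ‖c‖ ^ 2 * sqNorm ψ := by
  simp [sqNorm, Finset.mul_sum, mul_pow]

theorem sqNorm_single {S : Type} [Fintype S] [DecidableEq S] (s : S) :
    sqNorm (Pi.single s 1 : S → ℂ) = 1 := by
  simp [sqNorm, Pi.single_apply, apply_ite]

/-- This is `(x + y)² ≤ 2x² + 2y²` in each coordinate; it bounds the residual of a single row of the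
path matrix without using the angle between `φ` and `χ`. -/
theorem sqNorm_combination_le {S : Type} [Fintype S] (a b : ℝ) (φ χ : S → ℂ)
    (hφ : sqNorm φ = 1) (hχ : sqNorm χ = 1) :
    sqNorm (((a / 2 : ℝ) : ℂ) • φ + ((b / 2 : ℝ) : ℂ) • χ) ≤ (a ^ 2 + b ^ 2) / 2 := by
  have h : ∀ s, ‖(((a / 2 : ℝ) : ℂ) • φ + ((b / 2 : ℝ) : ℂ) • χ) s‖ ^ 2 ≤
      a ^ 2 / 2 * ‖φ s‖ ^ 2 + b ^ 2 / 2 * ‖χ s‖ ^ 2 := by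
    intro s
    have h1 : ‖(((a / 2 : ℝ) : ℂ) • φ + ((b / 2 : ℝ) : ℂ) • χ) s‖ ≤
        |a| / 2 * ‖φ s‖ + |b| / 2 * ‖χ s‖ := by
      refine (norm_add_le _ _).trans_eq ?_
      simp
    have h2 := pow_le_pow_left₀ (norm_nonneg _) h1 2
    have ha := sq_abs a
    have hb := sq_abs b
    nlinarith [sq_nonneg (|a| * ‖φ s‖ - |b| * ‖χ s‖)]
  calc sqNorm (((a / 2 : ℝ) : ℂ) • φ + ((b / 2 : ℝ) : ℂ) • χ)
      ≤ ∑ s, (a ^ 2 / 2 * ‖φ s‖ ^ 2 + b ^ 2 / 2 * ‖χ s‖ ^ 2) := Finset.sum_le_sum fun s _ => h s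
    _ = a ^ 2 / 2 * sqNorm φ + b ^ 2 / 2 * sqNorm χ := by
        simp [sqNorm, Finset.mul_sum, Finset.sum_add_distrib]
    _ = (a ^ 2 + b ^ 2) / 2 := by rw [hφ, hχ]; ring

/-! ### The weight of a set of outputs -/

namespace Program

variable {X W : Type} [Fintype X] [DecidableEq X] [Fintype W] [DecidableEq W]
  (O : Matrix.unitaryGroup X ℂ)

/-- The Born weight with which the output of `p` lies in `B`. -/
def mass (B : Set ℝ) (p : Program X W) (ψ : X × W → ℂ) : ℝ≥0∞ :=
  ∑' y, B.indicator (p.weight O ψ) y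

variable {O} {B : Set ℝ}

theorem mass_le (p : Program X W) (ψ : X × W → ℂ) : p.mass O B ψ ≤ ENNReal.ofReal (sqNorm ψ) := by
  rw [← tsum_weight O p ψ]
  exact ENNReal.tsum_le_tsum fun y => Set.indicator_le_self _ _ _

theorem mass_output_of_notMem {y : ℝ} (hy : y ∉ B) (ψ : X × W → ℂ) :
    (output y : Program X W).mass O B ψ = 0 := by
  refine ENNReal.tsum_eq_zero.mpr fun z => ?_
  by_cases hz : z ∈ B
  · rw [Set.indicator_of_mem hz]
    exact if_neg fun h : z = y => hy (h ▸ hz)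
  · exact Set.indicator_of_notMem hz _

theorem mass_unitary (U : Matrix.unitaryGroup (X × W) ℂ) (p : Program X W) (ψ : X × W → ℂ) :
    (unitary U p).mass O B ψ = p.mass O B ((U : Matrix (X × W) (X × W) ℂ) *ᵥ ψ) := rfl

theorem mass_query (b : Bool) (p : Program X W) (ψ : X × W → ℂ) :
    (query b p).mass O B ψ = p.mass O B (oracleStep O b *ᵥ ψ) := rfl

theorem mass_measure {m : ℕ} (N : Fin m → Matrix (X × W) (X × W) ℂ)
    (hN : ∑ j, (N j)ᴴ * N j = 1) (p : Fin m → Program X W) (ψ : X × W → ℂ) :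
    (measure m N hN p).mass O B ψ = ∑ j, (p j).mass O B (N j *ᵥ ψ) := by
  unfold mass
  rw [← Summable.tsum_finsetSum fun _ _ => ENNReal.summable]
  refine tsum_congr fun y => ?_
  by_cases hy : y ∈ B
  · simp [hy, weight]
  · simp [hy]

theorem weight_smul (p : Program X W) (c : ℂ) (ψ : X × W → ℂ) (y : ℝ) :
    p.weight O (c • ψ) y = ENNReal.ofReal (‖c‖ ^ 2) * p.weight O ψ y := by
  induction p generalizing ψ with
  | output y₀ =>
    simp only [weight]
    split_ifs
    · rw [sqNorm_smul, ENNReal.ofReal_mul (sq_nonneg _)]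
    · simp
  | unitary U next ih => simp only [weight]; rw [Matrix.mulVec_smul, ih]
  | query b next ih => simp only [weight]; rw [Matrix.mulVec_smul, ih]
  | measure m N hN next ih =>
    simp only [weight, Finset.mul_sum]
    exact Finset.sum_congr rfl fun j _ => by rw [Matrix.mulVec_smul, ih]

theorem mass_smul (p : Program X W) (c : ℂ) (ψ : X × W → ℂ) :
    p.mass O B (c • ψ) = ENNReal.ofReal (‖c‖ ^ 2) * p.mass O B ψ := by
  unfold mass
  rw [← ENNReal.tsum_mul_left]
  refine tsum_congr fun y => ?_
  by_cases hy : y ∈ B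
  · simp [hy, weight_smul]
  · simp [hy]

/-! ### Error bounds uniform over the input state -/

variable (O B)

/-- From every state, `p` outputs an element of `B` with conditional probability at most `β`. -/
def HitsAtMost (β : ℝ) (p : Program X W) : Prop :=
  ∀ ψ, p.mass O B ψ ≤ ENNReal.ofReal (β * sqNorm ψ)

variable {O B}

theorem hitsAtMost_one (p : Program X W) : p.HitsAtMost O B 1 := fun ψ => by
  simpa using mass_le p ψ

theorem hitsAtMost_output {y : ℝ} (hy : y ∉ B) (β : ℝ) :
    (output y : Program X W).HitsAtMost O B β := fun ψ => by
  rw [mass_output_of_notMem hy]; exact zero_le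

theorem HitsAtMost.mono {β γ : ℝ} {p : Program X W} (h : p.HitsAtMost O B β) (hβ : β ≤ γ) :
    p.HitsAtMost O B γ := fun ψ =>
  (h ψ).trans (ENNReal.ofReal_le_ofReal (mul_le_mul_of_nonneg_right hβ (sqNorm_nonneg ψ)))

theorem measure_mass_le {m : ℕ} {N : Fin m → Matrix (X × W) (X × W) ℂ}
    {hN : ∑ j, (N j)ᴴ * N j = 1} {p : Fin m → Program X W} {β : Fin m → ℝ}
    (hβ : ∀ j, 0 ≤ β j) (h : ∀ j, (p j).HitsAtMost O B (β j)) (ψ : X × W → ℂ) :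
    (measure m N hN p).mass O B ψ ≤ ENNReal.ofReal (∑ j, β j * sqNorm (N j *ᵥ ψ)) := by
  rw [mass_measure, ENNReal.ofReal_sum_of_nonneg fun j _ => mul_nonneg (hβ j) (sqNorm_nonneg _)]
  exact Finset.sum_le_sum fun j _ => h j _

/-! ### Preparing a state -/

/-- The measurement operators are `|φ⟩⟨s|` for the basis states `s`, so each product `|s⟩⟨φ|φ⟩⟨s|`
is the projection to `s`. -/
theorem sum_prepare {S : Type} [Fintype S] [DecidableEq S] {m : ℕ} (e : Fin m ≃ S) {φ : S → ℂ}
    (hφ : sqNorm φ = 1) :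
    ∑ j, (Matrix.vecMulVec φ (Pi.single (e j) 1))ᴴ * Matrix.vecMulVec φ (Pi.single (e j) 1) = 1 := by
  have h1 : star φ ⬝ᵥ φ = 1 := by rw [← ofReal_sqNorm, hφ]; simp
  have h2 : ∀ j, (Matrix.vecMulVec φ (Pi.single (e j) 1))ᴴ * Matrix.vecMulVec φ (Pi.single (e j) 1)
      = Matrix.single (e j) (e j) (1 : ℂ) := by
    intro j
    rw [Matrix.conjTranspose_vecMulVec, Matrix.vecMulVec_mul_vecMulVec, h1]
    ext a b
    by_cases ha : a = e j <;> by_cases hb : b = e j <;>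
      simp [Matrix.vecMulVec_apply, ha, hb, eq_comm]
  simp only [h2]
  rw [Equiv.sum_comp e fun s => Matrix.single s s (1 : ℂ)]
  ext a b
  simp [Matrix.sum_apply, Matrix.single_apply, Matrix.one_apply, ite_and]

/-- Replace the current state by the normalized state `φ`. -/
def prepare (φ : X × W → ℂ) (hφ : sqNorm φ = 1) (p : Program X W) : Program X W :=
  measure (Fintype.card (X × W)) _ (sum_prepare (Fintype.equivFin (X × W)).symm hφ) fun _ => p

/-- Outcome `s` leaves `ψ s • φ`, so the old state survives only through its norm. This makes
successive estimates in one program independent. -/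
theorem mass_prepare {φ : X × W → ℂ} (hφ : sqNorm φ = 1) (p : Program X W) (ψ : X × W → ℂ) :
    (prepare φ hφ p).mass O B ψ = ENNReal.ofReal (sqNorm ψ) * p.mass O B φ := by
  unfold prepare
  rw [mass_measure]
  have h : ∀ s, Matrix.vecMulVec φ (Pi.single s 1) *ᵥ ψ = ψ s • φ := by
    intro s
    rw [Matrix.vecMulVec_mulVec]
    ext
    simp [mul_comm]
  simp only [h, mass_smul]
  rw [← Finset.sum_mul, ← ENNReal.ofReal_sum_of_nonneg fun _ _ => sq_nonneg _,
    Equiv.sum_comp (Fintype.equivFin (X × W)).symm fun s => ‖ψ s‖ ^ 2]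
  rfl

theorem queries_prepare {φ : X × W → ℂ} (hφ : sqNorm φ = 1) (p : Program X W) :
    (prepare φ hφ p).queries ≤ p.queries := by
  unfold prepare
  simp only [queries]
  exact Finset.sup_le fun _ _ => le_rfl

/-! ### Uniformly random choices -/

theorem sum_uniform {S : Type} [Fintype S] [DecidableEq S] {m : ℕ} (hm : m ≠ 0) :
    ∑ _j : Fin m, (((Real.sqrt (1 / m) : ℝ) : ℂ) • (1 : Matrix S S ℂ))ᴴ *
      (((Real.sqrt (1 / m) : ℝ) : ℂ) • (1 : Matrix S S ℂ)) = 1 := by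
  have h : ((Real.sqrt (1 / m) : ℝ) : ℂ) * ((Real.sqrt (1 / m) : ℝ) : ℂ) = 1 / m := by
    rw [← Complex.ofReal_mul, Real.mul_self_sqrt (by positivity)]
    simp
  rw [Matrix.conjTranspose_smul, Matrix.conjTranspose_one, Matrix.smul_mul, Matrix.one_mul, smul_smul,
    RCLike.star_def, Complex.conj_ofReal, h]
  simp [← Nat.cast_smul_eq_nsmul ℂ, smul_smul, hm]

/-- Output a uniformly random entry of `y`. -/
def outputUniform {m : ℕ} (hm : m ≠ 0) (y : Fin m → ℝ) : Program X W :=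
  measure m _ (sum_uniform hm) fun j => output (y j)

/-- The operators `1/√m` ignore the state, so the single good index `j₀` is drawn with conditional
probability `1/m`. -/
theorem hitsAtMost_outputUniform {m : ℕ} (hm : m ≠ 0) {y : Fin m → ℝ} {j₀ : Fin m}
    (h : y j₀ ∉ B) :
    (outputUniform hm y : Program X W).HitsAtMost O B (1 - 1 / m) := by
  intro ψ
  refine (measure_mass_le (β := fun j => if j = j₀ then 0 else 1) (fun j => by split_ifs <;> simp)
    (fun j => ?_) ψ).trans_eq ?_
  · split_ifs with hj
    · subst hj; exact hitsAtMost_output h _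
    · exact hitsAtMost_one _
  · have h1 : ∀ j : Fin m, (if j = j₀ then (0 : ℝ) else 1) = 1 - if j = j₀ then 1 else 0 := by
      intro j; split_ifs <;> simp
    simp only [Matrix.smul_mulVec, Matrix.one_mulVec, sqNorm_smul]
    rw [← Finset.sum_mul]
    simp only [h1, Finset.sum_sub_distrib]
    have hm' : (m : ℝ) ≠ 0 := by exact_mod_cast hm
    rw [Complex.norm_real, Real.norm_eq_abs, sq_abs, Real.sq_sqrt (by positivity)]
    simp
    congr 1
    field_simp

theorem queries_outputUniform {m : ℕ} (hm : m ≠ 0) (y : Fin m → ℝ) :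
    (outputUniform hm y : Program X W).queries = 0 := by
  simp [outputUniform, queries]

end Program

open Program

/-! ### A register of counters -/

/-- The joint state whose component at the counter value `k` is `φ k`. -/
def stack {X Q K : Type} (φ : K → X × Q → ℂ) : X × (Q × K) → ℂ := fun s => φ s.2.2 (s.1, s.2.1)

section Stack

variable {X Q K : Type} [Fintype X] [DecidableEq X] [Fintype Q] [DecidableEq Q]
  [Fintype K] [DecidableEq K]

omit [DecidableEq X] [DecidableEq Q] [DecidableEq K] in
theorem sqNorm_stack (φ : K → X × Q → ℂ) : sqNorm (stack φ) = ∑ k, sqNorm (φ k) := by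
  simp only [sqNorm]
  rw [← Fintype.sum_prod_type' fun k s => ‖φ k s‖ ^ 2]
  exact Fintype.sum_equiv ((Equiv.prodAssoc X Q K).symm.trans (Equiv.prodComm _ _)) _ _
    fun _ => rfl

theorem oracleStep_stack (O : Matrix.unitaryGroup X ℂ) (b : Bool) (φ : K → X × Q → ℂ) :
    oracleStep O b *ᵥ stack φ = stack fun k => oracleStep O b *ᵥ φ k := by
  ext ⟨x, q, k⟩
  simp [oracleStep, stack, Matrix.mulVec, dotProduct, Fintype.sum_prod_type,
    Matrix.kroneckerMap_apply, Matrix.one_apply]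

/-- The matrix that applies `N k` on the rest of the system if the counter is `k`. -/
def controlled (N : K → Matrix (X × Q) (X × Q) ℂ) : Matrix (X × (Q × K)) (X × (Q × K)) ℂ :=
  (Matrix.blockDiagonal N).submatrix (Equiv.prodAssoc X Q K).symm (Equiv.prodAssoc X Q K).symm

omit [DecidableEq X] [DecidableEq Q] in
theorem controlled_mulVec_stack (N : K → Matrix (X × Q) (X × Q) ℂ) (φ : K → X × Q → ℂ) :
    controlled N *ᵥ stack φ = stack fun k => N k *ᵥ φ k := by
  ext ⟨x, q, k⟩
  simp [controlled, stack, Matrix.mulVec, dotProduct, Fintype.sum_prod_type,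
    Matrix.blockDiagonal_apply]

/-- The unitary that applies `N k` on the rest of the system if the counter is `k`. -/
def controlledUnitary (N : K → Matrix.unitaryGroup (X × Q) ℂ) :
    Matrix.unitaryGroup (X × (Q × K)) ℂ :=
  ⟨controlled fun k => (N k : Matrix (X × Q) (X × Q) ℂ), by
    rw [Matrix.mem_unitaryGroup_iff', Matrix.star_eq_conjTranspose]
    unfold controlled
    rw [Matrix.conjTranspose_submatrix, Matrix.submatrix_mul_equiv,
      Matrix.blockDiagonal_conjTranspose, ← Matrix.blockDiagonal_mul]
    simp only [← Matrix.star_eq_conjTranspose, Matrix.UnitaryGroup.star_mul_self]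
    change (Matrix.blockDiagonal 1).submatrix _ _ = _
    rw [Matrix.blockDiagonal_one, Matrix.submatrix_one_equiv]⟩

theorem controlledUnitary_mulVec_stack (N : K → Matrix.unitaryGroup (X × Q) ℂ)
    (φ : K → X × Q → ℂ) :
    (controlledUnitary N : Matrix (X × (Q × K)) (X × (Q × K)) ℂ) *ᵥ stack φ =
      stack fun k => (N k : Matrix (X × Q) (X × Q) ℂ) *ᵥ φ k :=
  controlled_mulVec_stack _ _

/-- The unitary `N` on the counter. -/
def onCounter (N : Matrix.unitaryGroup K ℂ) : Matrix.unitaryGroup (X × (Q × K)) ℂ :=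
  ⟨(1 : Matrix X X ℂ) ⊗ₖ ((1 : Matrix Q Q ℂ) ⊗ₖ (N : Matrix K K ℂ)),
    Matrix.kronecker_mem_unitary (one_mem _) (Matrix.kronecker_mem_unitary (one_mem _) N.2)⟩

theorem onCounter_mulVec_stack (N : Matrix.unitaryGroup K ℂ) (φ : K → X × Q → ℂ) :
    (onCounter N : Matrix.unitaryGroup (X × (Q × K)) ℂ).1 *ᵥ stack φ =
      stack fun k => ∑ l, (N : Matrix K K ℂ) k l • φ l := by
  ext ⟨x, q, k⟩
  simp [onCounter, stack, Matrix.mulVec, dotProduct, Fintype.sum_prod_type,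
    Matrix.kroneckerMap_apply, Matrix.one_apply]

/-- The projection to the counter value `k`. -/
def counterProj (k : K) : Matrix (X × (Q × K)) (X × (Q × K)) ℂ :=
  Matrix.diagonal fun s => if s.2.2 = k then 1 else 0

theorem sum_counterProj {m : ℕ} :
    ∑ k : Fin m, (counterProj k : Matrix (X × (Q × Fin m)) (X × (Q × Fin m)) ℂ)ᴴ *
      counterProj k = 1 := by
  simp only [counterProj, Matrix.diagonal_conjTranspose, Matrix.diagonal_mul_diagonal]
  ext s t
  by_cases h : s = t <;> simp [Matrix.sum_apply, Matrix.one_apply, h]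

theorem counterProj_mulVec_stack (k : K) (φ : K → X × Q → ℂ) :
    counterProj k *ᵥ stack φ = stack fun l => if l = k then φ k else 0 := by
  ext ⟨x, q, l⟩
  by_cases h : l = k <;> simp [counterProj, Matrix.mulVec_diagonal, stack, h]

theorem sqNorm_counterProj_mulVec_stack (k : K) (φ : K → X × Q → ℂ) :
    sqNorm (counterProj k *ᵥ stack φ) = sqNorm (φ k) := by
  rw [counterProj_mulVec_stack, sqNorm_stack, Finset.sum_eq_single k]
  · simp
  · intro l _ hl; simp [hl, sqNorm]
  · simp

/-- A change of basis of the counter preserves the squared norm. -/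
theorem sum_sqNorm_unitary (N : Matrix.unitaryGroup K ℂ) (φ : K → X × Q → ℂ) :
    ∑ k, sqNorm (∑ l, (N : Matrix K K ℂ) k l • φ l) = ∑ k, sqNorm (φ k) := by
  rw [← sqNorm_stack, ← sqNorm_stack φ, ← onCounter_mulVec_stack]
  exact sqNorm_mulVec _ (Matrix.UnitaryGroup.star_mul_self _) _

end Stack

/-! ### The quantum walk of a reward oracle -/

section Walk

variable {X : Type} [Fintype X] [DecidableEq X]

/-- The reflection of the flag qubit that is controlled by the reward `f x`, with the upper left
entry `1 - 2 f x`. -/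
def rewardReflection (f : X → ℝ) : Matrix (X × Bool) (X × Bool) ℂ := fun s t =>
  if s.1 = t.1 then
    if s.2 = t.2 then (if s.2 then -((1 - 2 * f s.1 : ℝ) : ℂ) else ((1 - 2 * f s.1 : ℝ) : ℂ))
    else ((2 * Real.sqrt (f s.1 * (1 - f s.1)) : ℝ) : ℂ)
  else 0

omit [Fintype X] in
theorem rewardReflection_conjTranspose (f : X → ℝ) :
    (rewardReflection f)ᴴ = rewardReflection f := by
  ext ⟨x, b⟩ ⟨y, c⟩
  by_cases h : y = x
  · subst h
    cases b <;> cases c <;> simp [rewardReflection, Matrix.conjTranspose_apply]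
  · simp [rewardReflection, Matrix.conjTranspose_apply, h, Ne.symm h]

/-- On the flag qubit each block has rows `(a, b)` and `(b, -a)` with `a = 1 - 2f` and `b² = 4f(1 -
f)`, so `a² + b² = 1`. The range of `f` is what makes the square root exact. -/
theorem rewardReflection_mul_self {f : X → ℝ} (hf : ∀ x, f x ∈ Set.Icc (0 : ℝ) 1) :
    rewardReflection f * rewardReflection f = 1 := by
  have hs : ∀ x, ((Real.sqrt (f x * (1 - f x)) : ℝ) : ℂ) * ((Real.sqrt (f x * (1 - f x)) : ℝ) : ℂ) =
      f x * (1 - f x) := by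
    intro x
    rw [← Complex.ofReal_mul, Real.mul_self_sqrt (mul_nonneg (hf x).1 (by linarith [(hf x).2]))]
    push_cast
    ring
  ext ⟨x, b⟩ ⟨y, c⟩
  simp only [Matrix.mul_apply, Fintype.sum_prod_type, Fintype.sum_bool]
  rw [Finset.sum_eq_single x (by intro z _ hz; simp [rewardReflection, hz.symm]) (by simp)]
  by_cases h : x = y
  · subst h
    cases b <;> cases c <;> simp [rewardReflection] <;>
      first | ring1 | linear_combination 4 * hs x
  · simp [rewardReflection, h]

/-- The reflection about a basis state. -/
def basisReflection {Y : Type} [DecidableEq Y] (s : Y) : Matrix Y Y ℂ :=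
  Matrix.diagonal fun t => if t = s then 1 else -1

theorem basisReflection_mulVec {Y : Type} [Fintype Y] [DecidableEq Y] (s : Y) (v : Y → ℂ) :
    basisReflection s *ᵥ v = (2 * v s) • (Pi.single s 1 : Y → ℂ) - v := by
  ext t
  by_cases h : t = s
  · subst h; simp [basisReflection, Matrix.mulVec_diagonal]; ring
  · simp [basisReflection, Matrix.mulVec_diagonal, h]

theorem basisReflection_conjTranspose {Y : Type} [DecidableEq Y] (s : Y) :
    (basisReflection s)ᴴ = basisReflection s := by
  rw [basisReflection, Matrix.diagonal_conjTranspose]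
  congr 1
  ext t
  by_cases h : t = s <;> simp [h]

theorem basisReflection_mul_self {Y : Type} [Fintype Y] [DecidableEq Y] (s : Y) :
    basisReflection s * basisReflection s = 1 := by
  rw [basisReflection, Matrix.diagonal_mul_diagonal, ← Matrix.diagonal_one]
  congr 1
  ext t
  split_ifs <;> simp

variable (O : Matrix.unitaryGroup X ℂ) (f : X → ℝ) (x₀ : X)

/-- The reward reflection, conjugated by the oracle. -/
def conjReflection : Matrix (X × Bool) (X × Bool) ℂ :=
  oracleStep O true * (rewardReflection f * oracleStep O false)

/-- The walk operator: the product of the reflection about the initial state and of the reward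
reflection conjugated by the oracle. -/
def walk : Matrix (X × Bool) (X × Bool) ℂ :=
  basisReflection (x₀, false) * conjReflection O f

/-- The orbit of the initial state under the walk operator. -/
def orbit (k : ℕ) : X × Bool → ℂ := walk O f x₀ ^ k *ᵥ Pi.single (x₀, false) 1

theorem orbit_succ (k : ℕ) : orbit O f x₀ (k + 1) = walk O f x₀ *ᵥ orbit O f x₀ k := by
  rw [orbit, orbit, Matrix.mulVec_mulVec, pow_succ']

theorem oracleStep_true_eq (W : Type) [Fintype W] [DecidableEq W] :
    oracleStep (W := W) O true = (oracleStep O false)ᴴ := by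
  simp [oracleStep, Matrix.conjTranspose_kronecker]

theorem oracleStep_true_mul_false (W : Type) [Fintype W] [DecidableEq W] :
    oracleStep (W := W) O true * oracleStep O false = 1 := by
  rw [oracleStep_true_eq]; exact oracleStep_unitary O false

theorem oracleStep_false_mul_true (W : Type) [Fintype W] [DecidableEq W] :
    oracleStep (W := W) O false * oracleStep O true = 1 :=
  mul_eq_one_comm.mp (oracleStep_true_mul_false O W)

theorem conjReflection_conjTranspose : (conjReflection O f)ᴴ = conjReflection O f := by
  simp only [conjReflection, oracleStep_true_eq, Matrix.conjTranspose_mul,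
    Matrix.conjTranspose_conjTranspose, rewardReflection_conjTranspose, Matrix.mul_assoc]

variable {f}

theorem conjReflection_mul_self (hf : ∀ x, f x ∈ Set.Icc (0 : ℝ) 1) :
    conjReflection O f * conjReflection O f = 1 := by
  unfold conjReflection
  calc _ = oracleStep O true * (rewardReflection f *
          ((oracleStep O false * oracleStep O true) * rewardReflection f)) * oracleStep O false := by
        simp only [Matrix.mul_assoc]
    _ = 1 := by
        rw [oracleStep_false_mul_true, Matrix.one_mul, rewardReflection_mul_self hf,
          Matrix.mul_one, oracleStep_true_mul_false]

theorem sqNorm_orbit (hf : ∀ x, f x ∈ Set.Icc (0 : ℝ) 1) (k : ℕ) :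
    sqNorm (orbit O f x₀ k) = 1 := by
  induction k with
  | zero => rw [orbit, pow_zero, Matrix.one_mulVec, sqNorm_single]
  | succ k ih =>
    rw [orbit_succ, sqNorm_mulVec _ _ _, ih]
    rw [walk, Matrix.conjTranspose_mul, basisReflection_conjTranspose,
      conjReflection_conjTranspose, Matrix.mul_assoc, ← Matrix.mul_assoc (basisReflection _),
      basisReflection_mul_self, Matrix.one_mul, conjReflection_mul_self O hf]

/-- The mean of `f` in the state that the oracle prepares. -/
def oracleMean (O : Matrix.unitaryGroup X ℂ) (f : X → ℝ) (x₀ : X) : ℝ :=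
  ∑ x, ‖(O : Matrix X X ℂ) x x₀‖ ^ 2 * f x

theorem sum_sqNorm_column : ∑ x, ‖(O : Matrix X X ℂ) x x₀‖ ^ 2 = 1 := by
  have h := sqNorm_mulVec (O : Matrix X X ℂ) (Matrix.UnitaryGroup.star_mul_self O)
    (Pi.single x₀ 1)
  rw [sqNorm_single] at h
  rw [← h]
  simp [sqNorm]

/-- The oracle does not touch the flag and the reflection is diagonal in `x`, so the entry is the
average of `1 - 2 f x` under the measured law of `O|x₀⟩`. -/
theorem conjReflection_apply : (conjReflection O f) (x₀, false) (x₀, false) =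
    ((1 - 2 * oracleMean O f x₀ : ℝ) : ℂ) := by
  have h1 : ∀ x : X, (oracleStep (W := Bool) O true) (x₀, false) (x, false) =
      star ((O : Matrix X X ℂ) x x₀) := by intro x; simp [oracleStep]
  have h2 : ∀ x : X, (oracleStep (W := Bool) O true) (x₀, false) (x, true) = 0 := by
    intro x; simp [oracleStep]
  have h3 : ∀ x : X, (oracleStep (W := Bool) O false) (x, false) (x₀, false) =
      (O : Matrix X X ℂ) x x₀ := by intro x; simp [oracleStep]
  have h4 : ∀ x : X, (oracleStep (W := Bool) O false) (x, true) (x₀, false) = 0 := by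
    intro x; simp [oracleStep]
  have h5 : (1 - 2 * oracleMean O f x₀ : ℝ) =
      ∑ x, ‖(O : Matrix X X ℂ) x x₀‖ ^ 2 * (1 - 2 * f x) := by
    simp only [mul_sub, mul_one, Finset.sum_sub_distrib, sum_sqNorm_column, oracleMean,
      Finset.mul_sum]
    congr 1
    exact Finset.sum_congr rfl fun x _ => by ring
  rw [h5, conjReflection]
  simp only [Matrix.mul_apply, Fintype.sum_prod_type, Fintype.sum_bool, h1, h2, h3, h4,
    zero_mul, mul_zero, zero_add]
  rw [Complex.ofReal_sum]
  refine Finset.sum_congr rfl fun x _ => ?_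
  rw [Finset.sum_eq_single x (by intro z _ hz; simp [rewardReflection, hz.symm]) (by simp)]
  have h6 : (star ((O : Matrix X X ℂ) x x₀)) * (O : Matrix X X ℂ) x x₀ =
      ((‖(O : Matrix X X ℂ) x x₀‖ ^ 2 : ℝ) : ℂ) := by
    rw [RCLike.star_def, Complex.conj_mul']; push_cast; rfl
  rw [Complex.ofReal_mul, ← h6]
  simp [rewardReflection]
  ring

/-- The three-term recurrence of Chebyshev polynomials. -/
theorem orbit_recurrence (hf : ∀ x, f x ∈ Set.Icc (0 : ℝ) 1) (k : ℕ) :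
    orbit O f x₀ (k + 2) + orbit O f x₀ k =
      (2 * ((1 - 2 * oracleMean O f x₀ : ℝ) : ℂ)) • orbit O f x₀ (k + 1) := by
  induction k with
  | zero =>
    set c : ℂ := ((1 - 2 * oracleMean O f x₀ : ℝ) : ℂ) with hc
    set s : X × Bool → ℂ := Pi.single (x₀, false) 1 with hs
    have h0 : orbit O f x₀ 0 = s := by rw [orbit, pow_zero, Matrix.one_mulVec]
    have h1 : orbit O f x₀ 1 = (2 * c) • s - conjReflection O f *ᵥ s := by
      rw [orbit_succ, h0, walk, ← Matrix.mulVec_mulVec, basisReflection_mulVec]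
      congr 3
      rw [hs, Matrix.mulVec_single_one, Matrix.col_apply, conjReflection_apply]
    have hR : basisReflection (x₀, false) *ᵥ s = s := by
      rw [basisReflection_mulVec, hs]
      simp
      rw [two_smul, add_sub_cancel_right]
    have h2 : orbit O f x₀ 2 = (2 * c) • orbit O f x₀ 1 - s := by
      -- The walk is a product of two involutions, the outer one fixing `s`; hence the span of `s`
      -- and its image under `conjReflection` is invariant, and the recurrence follows from `walk² s
      -- = 2c walk s - s`.
      have h3 : walk O f x₀ *ᵥ (conjReflection O f *ᵥ s) = s := by
        rw [walk, Matrix.mulVec_mulVec, Matrix.mul_assoc, conjReflection_mul_self O hf,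
          Matrix.mul_one, hR]
      have h4 : walk O f x₀ *ᵥ s = orbit O f x₀ 1 := by rw [orbit_succ, h0]
      rw [orbit_succ, h1, Matrix.mulVec_sub, Matrix.mulVec_smul, h3, h4, h1]
    rw [zero_add, zero_add, h2, h0, sub_add_cancel]
  | succ k ih =>
    rw [orbit_succ _ _ _ (k + 2), orbit_succ _ _ _ k, ← Matrix.mulVec_add, ih, Matrix.mulVec_smul,
      ← orbit_succ]

end Walk

/-! ### The path observable and a smooth window -/

/-- Half the adjacency matrix of the path on `M + 1` vertices. -/
def pathMatrix (M : ℕ) : Matrix (Fin (M + 1)) (Fin (M + 1)) ℂ := fun k l =>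
  (if (l : ℕ) + 1 = k then 1 / 2 else 0) + (if (l : ℕ) = k + 1 then 1 / 2 else 0)

theorem pathMatrix_isHermitian (M : ℕ) : (pathMatrix M).IsHermitian := by
  ext k l
  simp only [pathMatrix, Matrix.conjTranspose_apply, star_add, apply_ite star, star_zero, star_div₀,
    star_one, star_ofNat]
  rw [add_comm]
  congr 1 <;> simp [eq_comm]

/-- The spectral theorem suffices: the explicit eigenvalues are never needed, because the error
analysis uses only a second moment. -/
theorem exists_diagonalization (M : ℕ) : ∃ (V : Matrix.unitaryGroup (Fin (M + 1)) ℂ)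
    (ev : Fin (M + 1) → ℝ), (V : Matrix _ _ ℂ) * pathMatrix M =
      Matrix.diagonal (fun k => (ev k : ℂ)) * (V : Matrix _ _ ℂ) := by
  have hC := pathMatrix_isHermitian M
  refine ⟨star hC.eigenvectorUnitary, hC.eigenvalues, ?_⟩
  have h := hC.conjStarAlgAut_star_eigenvectorUnitary
  rw [Unitary.conjStarAlgAut_star_apply] at h
  have h2 : (Matrix.diagonal fun k => ((hC.eigenvalues k : ℝ) : ℂ)) =
      Matrix.diagonal (RCLike.ofReal ∘ hC.eigenvalues) := rfl
  rw [h2, ← h, Unitary.coe_star, Matrix.mul_assoc,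
    Matrix.mem_unitaryGroup_iff.mp hC.eigenvectorUnitary.2, Matrix.mul_one]

/-- A unitary that diagonalizes the path matrix. -/
def pathBasis (M : ℕ) : Matrix.unitaryGroup (Fin (M + 1)) ℂ := (exists_diagonalization M).choose

/-- The eigenvalues of the path matrix. -/
def pathEigenvalue (M : ℕ) : Fin (M + 1) → ℝ := (exists_diagonalization M).choose_spec.choose

theorem pathBasis_mul (M : ℕ) : (pathBasis M : Matrix _ _ ℂ) * pathMatrix M =
    Matrix.diagonal (fun k => (pathEigenvalue M k : ℂ)) * (pathBasis M : Matrix _ _ ℂ) :=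
  (exists_diagonalization M).choose_spec.choose_spec

/-- Since `χ` vanishes at `0` and at `M + 1`, the endpoints of the path need no special rule; at `k
= 0` the truncated `k - 1` is `0`, where the term is zero. -/
theorem sum_pathMatrix_smul {Y : Type} {M : ℕ} (χ : ℕ → Y → ℂ) (h0 : χ 0 = 0)
    (hM : χ (M + 1) = 0) (k : Fin (M + 1)) :
    ∑ l : Fin (M + 1), pathMatrix M k l • χ l =
      (1 / 2 : ℂ) • χ (k - 1) + (1 / 2 : ℂ) • χ (k + 1) := by
  simp only [pathMatrix, add_smul, Finset.sum_add_distrib, ite_smul, zero_smul]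
  rw [Fin.sum_univ_eq_sum_range fun l => if l + 1 = (k : ℕ) then (1 / 2 : ℂ) • χ l else 0,
    Fin.sum_univ_eq_sum_range fun l => if l = (k : ℕ) + 1 then (1 / 2 : ℂ) • χ l else 0]
  congr 1
  · obtain ⟨k, hk⟩ := k
    rcases k with _ | k
    · simp [h0]
    · rw [Finset.sum_eq_single k (by intro l _ hl; simp [hl]) (by simp; omega)]
      simp
  · rw [Finset.sum_ite_eq']
    split_ifs with h
    · rfl
    · have h2 : (k : ℕ) + 1 = M + 1 := by
        have := k.2
        rw [Finset.mem_range] at h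
        omega
      rw [h2, hM, smul_zero]

/-- A sequence that obeys the Chebyshev recurrence and is weighted by a slowly varying window is
almost an eigenvector of the path matrix. -/
theorem sum_sqNorm_path_sub_le {Y : Type} [Fintype Y] {M : ℕ} {t : ℕ → Y → ℂ} {c : ℂ}
    (ht : ∀ k, sqNorm (t k) = 1) (hr : ∀ k, t (k + 2) + t k = (2 * c) • t (k + 1))
    (w : ℕ → ℝ) (h0 : w 0 = 0) (hM : w (M + 1) = 0) :
    ∑ k : Fin (M + 1), sqNorm ((∑ l : Fin (M + 1), pathMatrix M k l • ((w l : ℂ) • t l)) -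
        c • ((w k : ℂ) • t k)) ≤
      ∑ k ∈ Finset.range (M + 1), (w (k + 1) - w k) ^ 2 := by
  have hk : ∀ k : Fin (M + 1), (∑ l : Fin (M + 1), pathMatrix M k l • ((w l : ℂ) • t l)) =
      (1 / 2 : ℂ) • ((w (k - 1) : ℂ) • t (k - 1)) + (1 / 2 : ℂ) • ((w (k + 1) : ℂ) • t (k + 1)) :=
    sum_pathMatrix_smul (fun l => (w l : ℂ) • t l) (by simp [h0]) (by simp [hM])
  simp only [hk]
  rw [Fin.sum_univ_eq_sum_range fun k => sqNorm ((1 / 2 : ℂ) • ((w (k - 1) : ℂ) • t (k - 1)) +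
    (1 / 2 : ℂ) • ((w (k + 1) : ℂ) • t (k + 1)) - c • ((w k : ℂ) • t k))]
  have hz : sqNorm ((1 / 2 : ℂ) • ((w (0 - 1) : ℂ) • t (0 - 1)) +
      (1 / 2 : ℂ) • ((w (0 + 1) : ℂ) • t (0 + 1)) - c • ((w 0 : ℂ) • t 0)) ≤
      (w 1 - w 0) ^ 2 / 2 := by
    have : (1 / 2 : ℂ) • ((w (0 - 1) : ℂ) • t (0 - 1)) +
        (1 / 2 : ℂ) • ((w (0 + 1) : ℂ) • t (0 + 1)) - c • ((w 0 : ℂ) • t 0) =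
        (1 / 2 * (w 1 : ℂ)) • t 1 := by
      rw [← smul_smul]; simp [h0]
    rw [this, sqNorm_smul, ht, h0]
    simp [mul_pow]
    nlinarith [sq_nonneg (w 1)]
  have hs : ∀ k, sqNorm ((1 / 2 : ℂ) • ((w (k + 1 - 1) : ℂ) • t (k + 1 - 1)) +
      (1 / 2 : ℂ) • ((w (k + 1 + 1) : ℂ) • t (k + 1 + 1)) - c • ((w (k + 1) : ℂ) • t (k + 1))) ≤
      ((w (k + 1 + 1) - w (k + 1)) ^ 2 + (w (k + 1) - w k) ^ 2) / 2 := by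
    intro k
    have : (1 / 2 : ℂ) • ((w (k + 1 - 1) : ℂ) • t (k + 1 - 1)) +
        (1 / 2 : ℂ) • ((w (k + 1 + 1) : ℂ) • t (k + 1 + 1)) - c • ((w (k + 1) : ℂ) • t (k + 1)) =
        ((((w (k + 1 + 1) - w (k + 1)) / 2 : ℝ) : ℂ)) • t (k + 2) +
        ((((w k - w (k + 1)) / 2 : ℝ) : ℂ)) • t k := by
      -- The recurrence rewrites the eigenvalue term through the two neighbours, so only differences
      -- of the window remain.
      have h2 : c • ((w (k + 1) : ℂ) • t (k + 1)) =
          (((w (k + 1) : ℂ)) / 2) • (t (k + 2) + t k) := by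
        rw [hr, smul_smul, smul_smul]
        congr 1
        ring
      rw [h2]
      ext s
      simp
      ring
    rw [this]
    refine (sqNorm_combination_le _ _ _ _ (ht _) (ht _)).trans_eq ?_
    ring
  -- Each squared difference enters two consecutive rows with weight `1/2`, except the last one,
  -- which enters only once; the final inequality adds its missing half.
  rw [Finset.sum_range_succ']
  have h1 := Finset.sum_le_sum fun k (_ : k ∈ Finset.range M) => hs k
  rw [← Finset.sum_div, Finset.sum_add_distrib] at h1
  have h2 := Finset.sum_range_succ' (fun k => (w (k + 1) - w k) ^ 2) M
  have h3 := Finset.sum_range_succ (fun k => (w (k + 1) - w k) ^ 2) M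
  simp only [zero_add] at h2 hz
  nlinarith [sq_nonneg (w (M + 1) - w M)]

/-- The parabolic window, before normalization. -/
def rawWindow (M k : ℕ) : ℝ := k * (M + 1 - k)

theorem sum_rawWindow_diff_sq (M : ℕ) :
    ∑ k ∈ Finset.range (M + 1), (rawWindow M (k + 1) - rawWindow M k) ^ 2 =
      M * (M + 1) * (M + 2) / 3 := by
  -- The number of terms is separated from the `M` inside the window, so that induction leaves the
  -- window fixed.
  have h : ∀ N : ℕ, ∑ k ∈ Finset.range N, (rawWindow M (k + 1) - rawWindow M k) ^ 2 =
      N * M ^ 2 - 2 * M * (N * (N - 1)) + 2 * ((N - 1) * N * (2 * N - 1)) / 3 := by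
    intro N
    induction N with
    | zero => simp
    | succ N ih =>
      rw [Finset.sum_range_succ, ih]
      simp only [rawWindow]
      push_cast
      ring
  rw [h]
  push_cast
  ring

theorem sum_rawWindow_sq (M : ℕ) :
    ∑ k ∈ Finset.range (M + 1), rawWindow M k ^ 2 =
      M * (M + 1) * (M + 2) * (M ^ 2 + 2 * M + 2) / 30 := by
  have h : ∀ N : ℕ, ∑ k ∈ Finset.range (N + 1), rawWindow M k ^ 2 =
      (M + 1 : ℝ) ^ 2 * (N * (N + 1) * (2 * N + 1) / 6) - 2 * (M + 1) * (N ^ 2 * (N + 1) ^ 2 / 4) +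
        N * (N + 1) * (2 * N + 1) * (3 * N ^ 2 + 3 * N - 1) / 30 := by
    intro N
    induction N with
    | zero => simp [rawWindow]
    | succ N ih =>
      rw [Finset.sum_range_succ, ih]
      simp only [rawWindow]
      push_cast
      ring
  rw [h]
  ring

/-- The normalized parabolic window. -/
def window (M k : ℕ) : ℝ :=
  rawWindow M k / Real.sqrt (M * (M + 1) * (M + 2) * (M ^ 2 + 2 * M + 2) / 30)

theorem window_zero (M : ℕ) : window M 0 = 0 := by simp [window, rawWindow]

theorem window_end (M : ℕ) : window M (M + 1) = 0 := by simp [window, rawWindow]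

theorem sum_window_sq {M : ℕ} (hM : 0 < M) : ∑ k ∈ Finset.range (M + 1), window M k ^ 2 = 1 := by
  have hM' : (0 : ℝ) < M := by exact_mod_cast hM
  simp only [window, div_pow]
  rw [← Finset.sum_div, sum_rawWindow_sq, Real.sq_sqrt (by positivity)]
  exact div_self (by positivity)

/-- The two closed forms share the factor `M(M+1)(M+2)`, so the quotient is `10 / (M² + 2M + 2)`. -/
theorem sum_window_diff_sq_le {M : ℕ} (hM : 0 < M) :
    ∑ k ∈ Finset.range (M + 1), (window M (k + 1) - window M k) ^ 2 ≤ 10 / M ^ 2 := by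
  have hM' : (0 : ℝ) < M := by exact_mod_cast hM
  simp only [window, ← sub_div, div_pow]
  rw [← Finset.sum_div, sum_rawWindow_diff_sq, Real.sq_sqrt (by positivity),
    div_le_div_iff₀ (by positivity) (by positivity)]
  have : 0 ≤ (M : ℝ) * (M + 1) * (M + 2) := by positivity
  nlinarith

/-! ### Amplitude estimation -/

section Estimation

variable {X : Type} [Fintype X] [DecidableEq X]

/-- The reward reflection as a unitary. -/
def rewardUnitary {f : X → ℝ} (hf : ∀ x, f x ∈ Set.Icc (0 : ℝ) 1) :
    Matrix.unitaryGroup (X × Bool) ℂ :=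
  ⟨rewardReflection f, by
    rw [Matrix.mem_unitaryGroup_iff', Matrix.star_eq_conjTranspose, rewardReflection_conjTranspose,
      rewardReflection_mul_self hf]⟩

/-- The reflection about a basis state as a unitary. -/
def basisUnitary (x₀ : X) : Matrix.unitaryGroup (X × Bool) ℂ :=
  ⟨basisReflection (x₀, false), by
    rw [Matrix.mem_unitaryGroup_iff', Matrix.star_eq_conjTranspose, basisReflection_conjTranspose,
      basisReflection_mul_self]⟩

variable {M : ℕ} {f : X → ℝ} (hf : ∀ x, f x ∈ Set.Icc (0 : ℝ) 1) (x₀ : X)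

/-- Apply the walk operator `min k n` times if the counter is `k`, then continue with `p`. -/
def walkSteps : ℕ → Program X (Bool × Fin (M + 1)) → Program X (Bool × Fin (M + 1))
  | 0, p => p
  | n + 1, p => walkSteps n <|
      query false <| unitary (controlledUnitary fun k => if n < (k : ℕ) then rewardUnitary hf else 1) <|
      query true <| unitary (controlledUnitary fun k => if n < (k : ℕ) then basisUnitary x₀ else 1) p

theorem queries_walkSteps (n : ℕ) (p : Program X (Bool × Fin (M + 1))) :
    (walkSteps hf x₀ n p).queries = p.queries + 2 * n := by
  induction n generalizing p with
  | zero => rfl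
  | succ n ih => simp only [walkSteps, ih, queries]; ring

/-- Only the reflections are controlled by the counter. The queries are unconditional: in an
inactive branch `O†` directly undoes `O`. -/
theorem mass_walkSteps (O : Matrix.unitaryGroup X ℂ) (B : Set ℝ) (w : ℕ → ℂ) (n : ℕ)
    (p : Program X (Bool × Fin (M + 1))) :
    (walkSteps hf x₀ n p).mass O B (stack fun k => w k • Pi.single (x₀, false) 1) =
      p.mass O B (stack fun k => w k • orbit O f x₀ (min k n)) := by
  induction n generalizing p with
  | zero =>
    have : orbit O f x₀ 0 = Pi.single (x₀, false) 1 := by rw [orbit, pow_zero, Matrix.one_mulVec]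
    simp [walkSteps, this]
  | succ n ih =>
    rw [walkSteps, ih, mass_query, mass_unitary, mass_query, mass_unitary, oracleStep_stack,
      controlledUnitary_mulVec_stack, oracleStep_stack, controlledUnitary_mulVec_stack]
    congr 2
    ext1 k
    split_ifs with h
    · rw [min_eq_right h.le, min_eq_right (Nat.succ_le_of_lt h), orbit_succ]
      simp only [Matrix.mulVec_smul, Matrix.mulVec_mulVec, walk, conjReflection]
      rfl
    · rw [min_eq_left (by omega), min_eq_left (by omega)]
      simp only [OneMemClass.coe_one, Matrix.mulVec_mulVec, Matrix.one_mul,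
        oracleStep_true_mul_false, Matrix.one_mulVec]

theorem sqNorm_windowState (hM : 0 < M) :
    sqNorm (stack fun k : Fin (M + 1) =>
      (window M k : ℂ) • (Pi.single (x₀, false) 1 : X × Bool → ℂ)) = 1 := by
  rw [sqNorm_stack]
  simp only [sqNorm_smul, sqNorm_single, mul_one, Complex.norm_real, Real.norm_eq_abs, sq_abs]
  rw [Fin.sum_univ_eq_sum_range fun k => window M k ^ 2, sum_window_sq hM]

/-- Amplitude estimation with `M` steps of the walk; the estimate is passed on to `next`. -/
def estimate (hM : 0 < M) (next : ℝ → Program X (Bool × Fin (M + 1))) :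
    Program X (Bool × Fin (M + 1)) :=
  prepare _ (sqNorm_windowState x₀ hM) <| walkSteps hf x₀ M <|
    unitary (onCounter (pathBasis M)) <|
    measure (M + 1) counterProj sum_counterProj fun k => next ((1 - pathEigenvalue M k) / 2)

theorem queries_estimate_le (hM : 0 < M) {next : ℝ → Program X (Bool × Fin (M + 1))} {q : ℕ}
    (h : ∀ z, (next z).queries ≤ q) : (estimate hf x₀ hM next).queries ≤ q + 2 * M := by
  refine (queries_prepare _ _).trans ?_
  rw [queries_walkSteps]
  simp only [queries]
  exact Nat.add_le_add_right (Finset.sup_le fun k _ => h _) _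

/-- The bound interpolates between `b₀` after a good estimate and `b₁` after a bad one, the latter
having probability at most `1/16`. Stating it for an arbitrary continuation allows estimates to be
chained. -/
theorem estimate_hitsAtMost (hM : 0 < M) (O : Matrix.unitaryGroup X ℂ) (B : Set ℝ)
    {next : ℝ → Program X (Bool × Fin (M + 1))} {ε b₀ b₁ : ℝ} (hε : 7 / M ≤ ε) (hb₀ : 0 ≤ b₀)
    (hb₁ : b₀ ≤ b₁) (h₀ : ∀ z, |z - oracleMean O f x₀| < ε → (next z).HitsAtMost O B b₀)
    (h₁ : ∀ z, (next z).HitsAtMost O B b₁) :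
    (estimate hf x₀ hM next).HitsAtMost O B (b₀ + (b₁ - b₀) / 16) := by
  intro ψ
  have hM' : (0 : ℝ) < M := by exact_mod_cast hM
  set c : ℝ := 1 - 2 * oracleMean O f x₀ with hc
  set z : Fin (M + 1) → ℝ := fun k => (1 - pathEigenvalue M k) / 2 with hz
  set φ : Fin (M + 1) → X × Bool → ℂ := fun k => (window M k : ℂ) • orbit O f x₀ k with hφ
  set V : Matrix (Fin (M + 1)) (Fin (M + 1)) ℂ := (pathBasis M).1 with hV
  set P : Fin (M + 1) → ℝ := fun k => sqNorm (∑ l, V k l • φ l) with hP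
  have hP0 : ∀ k, 0 ≤ P k := fun k => sqNorm_nonneg _
  have hP1 : ∑ k, P k = 1 := by
    rw [hP, sum_sqNorm_unitary]
    simp only [hφ, sqNorm_smul, sqNorm_orbit O x₀ hf, mul_one, Complex.norm_real, Real.norm_eq_abs,
      sq_abs]
    rw [Fin.sum_univ_eq_sum_range fun k => window M k ^ 2, sum_window_sq hM]
  -- In the eigenbasis the squared residual of the approximate eigenvector is exactly the second
  -- moment of the measured eigenvalue about `c`.
  have hvar : ∑ k, (pathEigenvalue M k - c) ^ 2 * P k ≤ 10 / M ^ 2 := by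
    have h2 := sum_sqNorm_path_sub_le (M := M) (sqNorm_orbit O x₀ hf) (orbit_recurrence O x₀ hf)
      (window M) (window_zero M) (window_end M)
    rw [← sum_sqNorm_unitary (pathBasis M)] at h2
    refine le_trans (le_of_eq ?_) (h2.trans (sum_window_diff_sq_le hM))
    refine Finset.sum_congr rfl fun k _ => ?_
    have h3 : (pathEigenvalue M k - c) ^ 2 = ‖((pathEigenvalue M k : ℂ) - (c : ℂ))‖ ^ 2 := by
      rw [← Complex.ofReal_sub, Complex.norm_real, Real.norm_eq_abs, sq_abs]
    rw [h3, hP, ← sqNorm_smul]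
    congr 1
    simp only [smul_sub, Finset.sum_sub_distrib, sub_smul]
    congr 1
    · have h4 : ∀ l, (pathEigenvalue M k : ℂ) * V k l = ∑ m, V k m * pathMatrix M m l := by
        intro l
        have := congrFun (congrFun (pathBasis_mul M) k) l
        rw [Matrix.mul_apply, Matrix.diagonal_mul] at this
        exact this.symm
      simp only [Finset.smul_sum, smul_smul _ _ (φ _), h4, Finset.sum_smul]
      rw [Finset.sum_comm]
      simp only [hφ, smul_smul, mul_assoc]
      rfl
    · rw [Finset.smul_sum]
      refine Finset.sum_congr rfl fun l _ => ?_
      rw [smul_comm]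
  have hbad : ∑ k, (if |z k - oracleMean O f x₀| < ε then 0 else P k) ≤ 1 / 16 := by
    have hε0 : 0 < ε := lt_of_lt_of_le (by positivity) hε
    have h2 : ∀ k, 4 * ε ^ 2 * (if |z k - oracleMean O f x₀| < ε then 0 else P k) ≤
        (pathEigenvalue M k - c) ^ 2 * P k := by
      intro k
      split_ifs with h
      · rw [mul_zero]; exact mul_nonneg (sq_nonneg _) (hP0 k)
      · refine mul_le_mul_of_nonneg_right ?_ (hP0 k)
        have h3 := pow_le_pow_left₀ hε0.le (not_lt.mp h) 2
        rw [sq_abs] at h3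
        have h4 : pathEigenvalue M k - c = -2 * (z k - oracleMean O f x₀) := by
          simp only [hz, hc]; ring
        rw [h4]
        nlinarith
    have h3 := (Finset.sum_le_sum fun k (_ : k ∈ Finset.univ) => h2 k).trans hvar
    rw [← Finset.mul_sum] at h3
    -- An estimate off by `ε` means an eigenvalue off by `2ε`, so the bad probability is at most `10
    -- / (4 * 49)`, which is below `1/16`.
    have h4 : 49 / (M : ℝ) ^ 2 ≤ ε ^ 2 := by
      have := pow_le_pow_left₀ (by positivity) hε 2
      rwa [div_pow, show (7 : ℝ) ^ 2 = 49 by norm_num] at this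
    have h5 : 10 / (M : ℝ) ^ 2 = 10 / 49 * (49 / (M : ℝ) ^ 2) := by ring
    have h6 : 0 < ε ^ 2 := by positivity
    rw [h5] at h3
    by_contra! h7
    nlinarith
  unfold estimate
  rw [mass_prepare, mass_walkSteps hf x₀ O B (fun k => (window M k : ℂ)), mass_unitary]
  have hmin : (stack fun k : Fin (M + 1) => (window M k : ℂ) • orbit O f x₀ (min k M)) =
      stack φ := by
    congr 1
    ext1 k
    rw [min_eq_left (Nat.lt_succ_iff.mp k.2)]
  rw [hmin, onCounter_mulVec_stack, mul_comm _ (sqNorm ψ),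
    ENNReal.ofReal_mul (sqNorm_nonneg ψ)]
  refine mul_le_mul_right ?_ _
  refine (measure_mass_le (β := fun k => if |z k - oracleMean O f x₀| < ε then b₀ else b₁)
    (fun k => ?_) (fun k => ?_) _).trans (ENNReal.ofReal_le_ofReal ?_)
  · split_ifs <;> linarith
  · split_ifs with h
    · exact h₀ _ h
    · exact h₁ _
  · simp only [sqNorm_counterProj_mulVec_stack]
    have h2 : ∀ k, (if |z k - oracleMean O f x₀| < ε then b₀ else b₁) * P k =
        b₀ * P k + (b₁ - b₀) * (if |z k - oracleMean O f x₀| < ε then 0 else P k) := by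
      intro k; split_ifs <;> ring
    calc _ = ∑ k, (if |z k - oracleMean O f x₀| < ε then b₀ else b₁) * P k := rfl
      _ = b₀ + (b₁ - b₀) * ∑ k, (if |z k - oracleMean O f x₀| < ε then 0 else P k) := by
        simp only [h2, Finset.sum_add_distrib, ← Finset.mul_sum, hP1, mul_one]
      _ ≤ _ := by nlinarith

end Estimation

theorem oracleMean_mem_Icc {X : Type} [Fintype X] [DecidableEq X] {f : X → ℝ}
    (hf : ∀ x, f x ∈ Set.Icc (0 : ℝ) 1) (O : Matrix.unitaryGroup X ℂ) (x₀ : X) :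
    oracleMean O f x₀ ∈ Set.Icc (0 : ℝ) 1 := by
  refine ⟨Finset.sum_nonneg fun x _ => mul_nonneg (sq_nonneg _) (hf x).1, ?_⟩
  rw [← sum_sqNorm_column O x₀]
  exact Finset.sum_le_sum fun x _ => mul_le_of_le_one_right (sq_nonneg _) (hf x).2

/-- An estimation procedure with accuracy `ε`, error probability `1 / 16` and `15 / ε` queries. -/
theorem exists_estimator {X : Type} [Fintype X] [DecidableEq X] {f : X → ℝ}
    (hf : ∀ x, f x ∈ Set.Icc (0 : ℝ) 1) (x₀ : X) {ε : ℝ} (hε : 0 < ε) :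
    ∃ (M : ℕ) (est : (ℝ → Program X (Bool × Fin (M + 1))) → Program X (Bool × Fin (M + 1))),
      (∀ (next : ℝ → Program X (Bool × Fin (M + 1))) (q : ℕ), (∀ z, (next z).queries ≤ q) →
        ((est next).queries : ℝ) ≤ q + 15 / ε) ∧
      ∀ (O : Matrix.unitaryGroup X ℂ) (B : Set ℝ) (next : ℝ → Program X (Bool × Fin (M + 1)))
        (b₀ b₁ : ℝ), 0 ≤ b₀ → b₀ ≤ b₁ →
        (∀ z, |z - oracleMean O f x₀| < ε → (next z).HitsAtMost O B b₀) →
        (∀ z, (next z).HitsAtMost O B b₁) → (est next).HitsAtMost O B (b₀ + (b₁ - b₀) / 16) := by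
  -- For `ε > 1/2` the constant `1/2` is accurate without queries. Otherwise `1/ε ≥ 2` absorbs the
  -- rounding in `2⌈7/ε⌉ ≤ 14/ε + 2`.
  rcases lt_or_ge (1 / 2) ε with h | h
  · refine ⟨0, fun next => next (1 / 2), fun next q hq => ?_, fun O B next b₀ b₁ _ hb h₀ _ => ?_⟩
    · have : ((next (1 / 2)).queries : ℝ) ≤ q := by exact_mod_cast hq _
      have : 0 ≤ 15 / ε := by positivity
      linarith
    · refine (h₀ _ ?_).mono (by linarith)
      have := oracleMean_mem_Icc hf O x₀
      rw [abs_lt]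
      constructor <;> linarith [this.1, this.2]
  · have hM : 0 < ⌈7 / ε⌉₊ := Nat.ceil_pos.mpr (by positivity)
    refine ⟨⌈7 / ε⌉₊, estimate hf x₀ hM, fun next q hq => ?_,
      fun O B next b₀ b₁ h0 hb h₀ h₁ => estimate_hitsAtMost hf x₀ hM O B ?_ h0 hb h₀ h₁⟩
    · have h1 : ((estimate hf x₀ hM next).queries : ℝ) ≤ q + 2 * (⌈7 / ε⌉₊ : ℝ) := by
        exact_mod_cast queries_estimate_le hf x₀ hM hq
      have h2 := (Nat.ceil_lt_add_one (show 0 ≤ 7 / ε by positivity)).le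
      have h3 : 2 ≤ 1 / ε := by
        rw [le_div_iff₀ hε]; linarith
      have h4 : 15 / ε = 2 * (7 / ε) + 1 / ε := by ring
      linarith
    · have h2 := Nat.le_ceil (7 / ε)
      rw [div_le_iff₀ (by exact_mod_cast hM)]
      rw [div_le_iff₀ hε] at h2
      linarith

/-! ### Amplification of the success probability -/

theorem exists_mem_of_length_lt_countP {α : Type*} (p q : α → Prop) [DecidablePred p]
    [DecidablePred q] (l : List α) (h : l.length < l.countP (p ·) + l.countP (q ·)) :
    ∃ z, p z ∧ q z := by
  by_contra! hn
  have hle : ∀ l : List α, l.countP (p ·) + l.countP (q ·) ≤ l.length := by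
    intro l
    induction l with
    | nil => simp
    | cons a l ih =>
      rw [List.countP_cons, List.countP_cons, List.length_cons]
      by_cases hp : p a
      · simp [hp, hn a hp]; omega
      · by_cases hq : q a <;> simp [hp, hq] <;> omega
  exact absurd (hle l) (not_le.mpr h)

open Classical in
/-- A number that is within `ε` of more than half of the entries of a list. -/
def majorityPoint (ε : ℝ) (l : List ℝ) : ℝ :=
  if h : ∃ y : ℝ, l.length < 2 * l.countP (fun z => |z - y| < ε) then h.choose else 0

-- Two strict majorities of one list share an entry, which is within `ε` of both centres.
open Classical in
theorem abs_majorityPoint_sub_lt {ε μ : ℝ} {l : List ℝ}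
    (h : l.length < 2 * l.countP (fun z => |z - μ| < ε)) : |majorityPoint ε l - μ| < 2 * ε := by
  have hex : ∃ y : ℝ, l.length < 2 * l.countP (fun z => |z - y| < ε) := ⟨μ, h⟩
  have h1 : majorityPoint ε l = hex.choose := dif_pos hex
  obtain ⟨z, h2, h3⟩ := exists_mem_of_length_lt_countP (fun z => |z - hex.choose| < ε)
    (fun z => |z - μ| < ε) l (by have := hex.choose_spec; omega)
  rw [h1]
  rw [abs_lt] at *
  constructor <;> linarith [h2.1, h2.2, h3.1, h3.2]

section Repeat

variable {X W : Type} [Fintype X] [DecidableEq X] [Fintype W] [DecidableEq W]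

/-- Collect `r` further estimates and output a function of the list of all estimates. -/
def repeatEstimate (est : (ℝ → Program X W) → Program X W) (out : List ℝ → ℝ) :
    ℕ → List ℝ → Program X W
  | 0, l => output (out l)
  | r + 1, l => est fun z => repeatEstimate est out r (z :: l)

/-- Query counts are integers, so each estimate really adds at most `⌊c⌋₊`; this keeps the bound
integral, as `hest` requires, along the induction. -/
theorem queries_repeatEstimate_le {est : (ℝ → Program X W) → Program X W} {c : ℝ}
    (hest : ∀ (next : ℝ → Program X W) (q : ℕ), (∀ z, (next z).queries ≤ q) →
      ((est next).queries : ℝ) ≤ q + c) (hc : 0 ≤ c) (out : List ℝ → ℝ) (r : ℕ) (l : List ℝ) :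
    ((repeatEstimate est out r l).queries : ℝ) ≤ r * c := by
  have h : ∀ (r : ℕ) (l : List ℝ), (repeatEstimate est out r l).queries ≤ r * ⌊c⌋₊ := by
    intro r
    induction r with
    | zero => intro l; simp [repeatEstimate, queries]
    | succ r ih =>
      intro l
      have h1 := hest _ _ fun z => ih (z :: l)
      have h2 : (est fun z => repeatEstimate est out r (z :: l)).queries ≤ ⌊(r * ⌊c⌋₊ : ℕ) + c⌋₊ :=
        Nat.le_floor h1
      rw [add_comm, Nat.floor_add_natCast hc] at h2
      rw [repeatEstimate]
      linarith
  have h1 : ((repeatEstimate est out r l).queries : ℝ) ≤ r * (⌊c⌋₊ : ℝ) := by exact_mod_cast h r l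
  exact h1.trans (mul_le_mul_of_nonneg_left (Nat.floor_le hc) (Nat.cast_nonneg r))

-- An exponential-moment argument: a bad estimate multiplies the potential by `9`, so one run
-- multiplies its mean by at most `1 + 8/16 = 3/2`. If the majority rule fails, at least `k/2`
-- estimates are bad and `9 ^ bad ≥ 3 ^ k`; dividing by `3 ^ k` makes the potential dominate the
-- failure probability.
open Classical in
theorem repeatEstimate_hitsAtMost {est : (ℝ → Program X W) → Program X W}
    {O : Matrix.unitaryGroup X ℂ} {B : Set ℝ} {ε μ : ℝ}
    (hest : ∀ (next : ℝ → Program X W) (b₀ b₁ : ℝ), 0 ≤ b₀ → b₀ ≤ b₁ →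
        (∀ z, |z - μ| < ε → (next z).HitsAtMost O B b₀) →
        (∀ z, (next z).HitsAtMost O B b₁) → (est next).HitsAtMost O B (b₀ + (b₁ - b₀) / 16))
    (hB : ∀ y, |y - μ| < 2 * ε → y ∉ B) (k r : ℕ) (l : List ℝ) (hl : l.length + r = k) :
    (repeatEstimate est (majorityPoint ε) r l).HitsAtMost O B
      ((3 / 2) ^ r * 9 ^ (l.length - l.countP (fun z => |z - μ| < ε)) / 3 ^ k) := by
  induction r generalizing l with
  | zero =>
    rw [repeatEstimate]
    by_cases h : l.length < 2 * l.countP (fun z => |z - μ| < ε)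
    · exact hitsAtMost_output (hB _ (abs_majorityPoint_sub_lt h)) _
    · refine (hitsAtMost_one _).mono ?_
      rw [pow_zero, one_mul, one_le_div (by positivity), show (9 : ℝ) = 3 ^ 2 by norm_num, ← pow_mul]
      exact pow_le_pow_right₀ (by norm_num) (by omega)
  | succ r ih =>
    have hc := List.countP_le_length (p := fun z => decide (|z - μ| < ε)) (l := l)
    set b : ℝ := (3 / 2) ^ r * 9 ^ (l.length - l.countP (fun z => |z - μ| < ε)) / 3 ^ k with hb
    have hb0 : 0 ≤ b := by positivity
    have h1 : (3 / 2 : ℝ) ^ (r + 1) * 9 ^ (l.length - l.countP (fun z => |z - μ| < ε)) / 3 ^ k =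
        b + (9 * b - b) / 16 := by rw [hb]; ring
    rw [h1, repeatEstimate]
    have h2 : ∀ z, |z - μ| < ε →
        (repeatEstimate est (majorityPoint ε) r (z :: l)).HitsAtMost O B b := by
      intro z hz
      have h3 := ih (z :: l) (by rw [List.length_cons]; omega)
      rwa [List.countP_cons_of_pos (by simpa using hz), List.length_cons,
        Nat.add_sub_add_right] at h3
    refine hest _ b (9 * b) hb0 (by linarith) h2 fun z => ?_
    by_cases hz : |z - μ| < ε
    · exact (h2 z hz).mono (by linarith)
    · have h3 := ih (z :: l) (by rw [List.length_cons]; omega)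
      rw [List.countP_cons_of_neg (by simpa using hz), List.length_cons,
        Nat.sub_add_comm hc, pow_succ] at h3
      exact h3.mono (by rw [hb]; exact le_of_eq (by ring))

end Repeat

/-! ### Quantum Monte Carlo -/

section QMC

variable {X : Type} [Fintype X] [DecidableEq X]

theorem exists_queryAlgorithm_of_le_half {f : X → ℝ} (hf : ∀ x, f x ∈ Set.Icc (0 : ℝ) 1) (x₀ : X)
    {ε δ : ℝ} (hε : 0 < ε) (hδ : 0 < δ) (hδ' : δ ≤ 1 / 2) :
    ∃ A : QueryAlgorithm X, (A.queries : ℝ) ≤ 120 / ε * Real.log (1 / δ) ∧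
      ∀ O : Matrix.unitaryGroup X ℂ,
        A.program.HitsAtMost O {z | ε ≤ |z - oracleMean O f x₀|} δ := by
  obtain ⟨M, est, hq, hest⟩ := exists_estimator hf x₀ (half_pos hε)
  have hL : Real.log 2 ≤ Real.log (1 / δ) := by
    refine Real.log_le_log (by norm_num) ?_
    rw [le_div_iff₀ hδ]; linarith
  have hl2 := Real.log_two_gt_d9
  set k : ℕ := ⌈Real.log (1 / δ) / Real.log 2⌉₊ with hk
  have hdiv : 1 ≤ Real.log (1 / δ) / Real.log 2 := by
    rw [le_div_iff₀ (by linarith)]; linarith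
  refine ⟨⟨Bool × Fin (M + 1), (false, 0), repeatEstimate est (majorityPoint (ε / 2)) k []⟩,
    ?_, fun O => ?_⟩
  · have h1 := queries_repeatEstimate_le hq (by positivity) (majorityPoint (ε / 2)) k []
    refine h1.trans ?_
    -- As `δ ≤ 1/2`, rounding `log₂ (1/δ)` up at most doubles it, and `1 / ln 2 ≤ 2`; with `30/ε`
    -- queries per run this yields the constant `120`.
    have h2 : (k : ℝ) ≤ 4 * Real.log (1 / δ) := by
      have h3 := (Nat.ceil_lt_add_one (show 0 ≤ Real.log (1 / δ) / Real.log 2 by linarith)).le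
      have h4 : Real.log (1 / δ) / Real.log 2 ≤ 2 * Real.log (1 / δ) := by
        rw [div_le_iff₀ (by linarith)]
        nlinarith
      linarith
    have h3 : 15 / (ε / 2) = 30 / ε := by field_simp; norm_num
    rw [h3]
    calc (k : ℝ) * (30 / ε) ≤ 4 * Real.log (1 / δ) * (30 / ε) :=
          mul_le_mul_of_nonneg_right h2 (by positivity)
      _ = _ := by ring
  · have h1 := repeatEstimate_hitsAtMost (est := est) (O := O)
      (B := {z | ε ≤ |z - oracleMean O f x₀|}) (ε := ε / 2) (μ := oracleMean O f x₀)
      (fun next b₀ b₁ => hest O _ next b₀ b₁)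
      (fun y hy => by simp only [Set.mem_ofPred_eq, not_le]; linarith) k k [] (by simp)
    refine h1.mono ?_
    have h2 : Real.log (1 / δ) ≤ k * Real.log 2 := by
      rw [← div_le_iff₀ (by linarith)]
      exact Nat.le_ceil _
    have h3 : 1 / δ ≤ 2 ^ k := by
      rw [← Real.log_pow] at h2
      exact (Real.log_le_log_iff (by positivity) (by positivity)).mp h2
    have h4 : (3 / 2 : ℝ) ^ k / 3 ^ k = 1 / 2 ^ k := by
      rw [← div_pow, ← one_div_pow]; norm_num
    simp only [List.length_nil, List.countP_nil, Nat.sub_self, pow_zero, mul_one]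
    rw [h4, div_le_iff₀ (by positivity)]
    rw [div_le_iff₀ hδ] at h3
    linarith

theorem exists_grid_point {ε ε' d : ℝ} (hε : 0 < ε) (hd : |d| < ε') {m : ℕ}
    (hm : 2 * ε' / ε ≤ m) : ∃ j : Fin m, |d - (-ε' + j * ε)| < ε := by
  rw [abs_lt] at hd
  have h0 : 0 ≤ (d + ε') / ε := div_nonneg (by linarith) hε.le
  have h1 := Nat.floor_le h0
  have h2 := Nat.lt_floor_add_one ((d + ε') / ε)
  rw [le_div_iff₀ hε] at h1
  rw [div_lt_iff₀ hε] at h2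
  have h3 : ⌊(d + ε') / ε⌋₊ < m := by
    rw [Nat.floor_lt h0]
    refine lt_of_lt_of_le ?_ hm
    exact div_lt_div_of_pos_right (by linarith) hε
  refine ⟨⟨_, h3⟩, ?_⟩
  rw [abs_lt]
  constructor <;> simp only <;> linarith

/-- The budget is only of order `p / ε` with `p = 1 - δ`, and success is needed only with
probability `p`. One run of accuracy `ε / (8p)` costs `120 p / ε` queries; about `1 / (4p)` shifts
of spacing `ε` then cover its error interval, and one is guessed uniformly. -/
theorem exists_queryAlgorithm_of_half_lt {f : X → ℝ} (hf : ∀ x, f x ∈ Set.Icc (0 : ℝ) 1) (x₀ : X)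
    {ε δ : ℝ} (hε : 0 < ε) (hδ : 1 / 2 < δ) (hδ' : δ < 1) :
    ∃ A : QueryAlgorithm X, (A.queries : ℝ) ≤ 120 / ε * Real.log (1 / δ) ∧
      ∀ O : Matrix.unitaryGroup X ℂ,
        A.program.HitsAtMost O {z | ε ≤ |z - oracleMean O f x₀|} δ := by
  set p : ℝ := 1 - δ with hp
  have hp0 : 0 < p := by linarith
  have hp1 : p < 1 / 2 := by linarith
  set ε' : ℝ := ε / (8 * p) with hε'
  have hε'0 : 0 < ε' := by positivity
  obtain ⟨M, est, hq, hest⟩ := exists_estimator hf x₀ hε'0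
  have hratio : 2 * ε' / ε = 1 / (4 * p) := by rw [hε']; field_simp; norm_num
  set m : ℕ := ⌈1 / (4 * p)⌉₊ with hm
  have hm0 : m ≠ 0 := (Nat.ceil_pos.mpr (by positivity)).ne'
  refine ⟨⟨Bool × Fin (M + 1), (false, 0),
    est fun z => outputUniform hm0 fun j => z - (-ε' + j * ε)⟩, ?_, fun O => ?_⟩
  · have h1 := hq (fun z => outputUniform hm0 fun j => z - (-ε' + j * ε)) 0 fun z =>
      (queries_outputUniform hm0 _).le
    refine h1.trans ?_
    have h2 : p ≤ Real.log (1 / δ) := by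
      have := Real.log_le_sub_one_of_pos (show 0 < δ by linarith)
      rw [one_div, Real.log_inv]
      linarith
    have h3 : 15 / ε' = 120 / ε * p := by rw [hε']; field_simp; norm_num
    rw [Nat.cast_zero, zero_add, h3]
    exact mul_le_mul_of_nonneg_left h2 (by positivity)
  · have hmR : (0 : ℝ) < m := by exact_mod_cast Nat.pos_of_ne_zero hm0
    have hm1 : 1 / (m : ℝ) ≤ 1 := by
      rw [div_le_one hmR]; exact_mod_cast Nat.pos_of_ne_zero hm0
    refine (hest O _ _ (1 - 1 / m) 1 (by linarith) (by simp) (fun z hz => ?_)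
      fun z => hitsAtMost_one _).mono ?_
    · obtain ⟨j, hj⟩ := exists_grid_point hε hz (hratio.le.trans (Nat.le_ceil _))
      refine hitsAtMost_outputUniform hm0 (j₀ := j) ?_
      simp only [Set.mem_ofPred_eq, not_le]
      rwa [sub_right_comm]
    · have h1 := (Nat.ceil_lt_add_one (show 0 ≤ 1 / (4 * p) by positivity)).le
      rw [← hm] at h1
      -- The success probability is at least `15 / (16 m)`, so this is exactly what makes it at
      -- least `p`.
      have h2 : p * m ≤ 15 / 16 := by
        have h3 : p * (1 / (4 * p) + 1) = 1 / 4 + p := by field_simp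
        nlinarith
      have h3 : p ≤ 15 / 16 / m := by rwa [le_div_iff₀ hmR]
      have h4 : (15 / 16 : ℝ) / m = 15 / 16 * (1 / m) := by ring
      rw [h4] at h3
      linarith

end QMC

theorem QueryAlgorithm.law_toOuterMeasure_le {X : Type} [Fintype X] [DecidableEq X]
    {A : QueryAlgorithm X} {x₀ : X} {O : Matrix.unitaryGroup X ℂ} {B : Set ℝ} {δ : ℝ}
    (h : A.program.HitsAtMost O B δ) : (A.law x₀ O).toOuterMeasure B ≤ ENNReal.ofReal δ := by
  have h1 := h (Pi.single (x₀, A.w₀) 1)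
  rw [sqNorm_single, mul_one] at h1
  rw [PMF.toOuterMeasure_apply]
  exact h1

namespace Arm

variable {Ω : Type} [Fintype Ω] [DecidableEq Ω] {V : Finset ℝ} {e₀ : Ω × V}

/-- The reward that is stored in the oracle register, clamped to the unit interval. -/
def clampedReward (x : Ω × V) : ℝ := max 0 (min 1 (x.2 : ℝ))

omit [Fintype Ω] [DecidableEq Ω] in
theorem clampedReward_mem_Icc (x : Ω × V) : clampedReward x ∈ Set.Icc (0 : ℝ) 1 :=
  ⟨le_max_left _ _, max_le zero_le_one (min_le_left _ _)⟩

/-- The encoding fixes the column `e₀` of the oracle. Clamping, needed for a reflection defined on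
all of `V`, changes only rewards of probability zero. -/
theorem oracleMean_eq_mean (a : Arm e₀) (ha : a.BoundedValue) :
    oracleMean a.O clampedReward e₀ = a.mean := by
  have h : ∀ ω v, (a.O : Matrix (Ω × V) (Ω × V) ℂ) (ω, v) e₀ =
      if v = a.y ω then ((Real.sqrt (a.P ω).toReal : ℝ) : ℂ) else 0 := by
    intro ω v
    have h1 := congrFun a.encodes (ω, v)
    rw [Matrix.mulVec_single_one, Matrix.col_apply] at h1
    rw [h1, Finset.sum_apply, Finset.sum_eq_single ω]
    · simp [Pi.single_apply]
    · intro ω' _ hω'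
      simp [hω'.symm]
    · simp
  unfold oracleMean mean
  rw [Fintype.sum_prod_type]
  refine Finset.sum_congr rfl fun ω _ => ?_
  rw [Finset.sum_eq_single (a.y ω) (by intro v _ hv; simp [h, hv]) (by simp), h, if_pos rfl,
    Complex.norm_real, Real.norm_eq_abs, sq_abs, Real.sq_sqrt ENNReal.toReal_nonneg]
  by_cases hP : a.P ω = 0
  · simp [hP]
  · have := ha ω hP
    rw [clampedReward, min_eq_right this.2, max_eq_right this.1]

end Arm

theorem exists_isQMC {Ω : Type} [Fintype Ω] [DecidableEq Ω] {V : Finset ℝ} (e₀ : Ω × V) :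
    ∃ QMC : ℝ → ℝ → QueryAlgorithm (Ω × V), IsQMC 120 e₀ QMC := by
  -- The algorithm is chosen before the oracle, so it cannot depend on the arm.
  have h : ∀ ε δ : ℝ, ∃ A : QueryAlgorithm (Ω × V), 0 < ε → 0 < δ → δ < 1 →
      (A.queries : ℝ) ≤ 120 / ε * Real.log (1 / δ) ∧ ∀ O : Matrix.unitaryGroup (Ω × V) ℂ,
        A.program.HitsAtMost O {z | ε ≤ |z - oracleMean O Arm.clampedReward e₀|} δ := by
    intro ε δ
    by_cases hc : 0 < ε ∧ 0 < δ ∧ δ < 1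
    · obtain ⟨hε, hδ, hδ'⟩ := hc
      rcases le_or_gt δ (1 / 2) with hh | hh
      · obtain ⟨A, hA⟩ := exists_queryAlgorithm_of_le_half Arm.clampedReward_mem_Icc e₀ hε hδ hh
        exact ⟨A, fun _ _ _ => hA⟩
      · obtain ⟨A, hA⟩ := exists_queryAlgorithm_of_half_lt Arm.clampedReward_mem_Icc e₀ hε hh hδ'
        exact ⟨A, fun _ _ _ => hA⟩
    · exact ⟨⟨Unit, (), output 0⟩, fun h1 h2 h3 => absurd ⟨h1, h2, h3⟩ hc⟩
  choose QMC hQMC using h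
  refine ⟨QMC, fun ε δ hε hδ hδ' => ⟨(hQMC ε δ hε hδ hδ').1, fun a ha => ?_⟩⟩
  have h1 := (hQMC ε δ hε hδ hδ').2 a.O
  rw [a.oracleMean_eq_mean ha] at h1
  exact QueryAlgorithm.law_toOuterMeasure_le h1

/-! ### Expectations -/

/-- The expectation of a nonnegative function. -/
def expect {α : Type*} (p : PMF α) (g : α → ℝ≥0∞) : ℝ≥0∞ := ∑' a, p a * g a

theorem expect_pure {α : Type*} (a : α) (g : α → ℝ≥0∞) : expect (PMF.pure a) g = g a := by
  unfold expect
  rw [tsum_eq_single a (by intro b hb; simp [PMF.pure_apply, hb])]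
  simp

theorem expect_bind {α β : Type*} (p : PMF α) (q : α → PMF β) (g : β → ℝ≥0∞) :
    expect (p.bind q) g = expect p fun a => expect (q a) g := by
  simp only [expect, PMF.bind_apply, ← ENNReal.tsum_mul_right, ← ENNReal.tsum_mul_left]
  rw [ENNReal.tsum_comm]
  simp only [mul_assoc]

theorem expect_map {α β : Type*} (p : PMF α) (f : α → β) (g : β → ℝ≥0∞) :
    expect (p.map f) g = expect p fun a => g (f a) := by
  rw [← PMF.bind_pure_comp, expect_bind]
  simp only [Function.comp, expect_pure]

theorem expect_le {α : Type*} (p : PMF α) {g : α → ℝ≥0∞} {b : ℝ≥0∞} (h : ∀ a, g a ≤ b) :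
    expect p g ≤ b := by
  calc expect p g ≤ ∑' a, p a * b := ENNReal.tsum_le_tsum fun a => by gcongr; exact h a
    _ = b := by rw [ENNReal.tsum_mul_right, p.tsum_coe, one_mul]

theorem expect_le_add {α : Type*} (p : PMF α) {g : α → ℝ≥0∞} {b c : ℝ≥0∞} (B : Set α)
    (hc : ∀ a, g a ≤ c) (h : ∀ a ∉ B, g a ≤ b) : expect p g ≤ b + p.toOuterMeasure B * c := by
  calc expect p g ≤ ∑' a, (p a * b + B.indicator p a * c) := by
        refine ENNReal.tsum_le_tsum fun a => ?_
        by_cases ha : a ∈ B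
        · rw [Set.indicator_of_mem ha]
          exact le_add_left (by gcongr; exact hc a)
        · exact le_add_right (by gcongr; exact h a ha)
    _ = b + p.toOuterMeasure B * c := by
        rw [ENNReal.tsum_add, ENNReal.tsum_mul_right, ENNReal.tsum_mul_right, p.tsum_coe, one_mul,
          PMF.toOuterMeasure_apply]

/-! ### The gaps of the arms -/

section Gap

variable {Ω : Type} [Fintype Ω] [DecidableEq Ω] {V : Finset ℝ} {e₀ : Ω × V}

theorem Arm.sum_toReal_P (a : Arm e₀) : ∑ ω, (a.P ω).toReal = 1 := by
  rw [← ENNReal.toReal_sum fun ω _ => a.P.apply_ne_top ω, ← tsum_fintype (L := .unconditional Ω),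
    a.P.tsum_coe, ENNReal.toReal_one]

theorem Arm.mean_mem_Icc (a : Arm e₀) (ha : a.BoundedValue) : a.mean ∈ Set.Icc (0 : ℝ) 1 := by
  have h : ∀ ω, 0 ≤ (a.P ω).toReal * (a.y ω : ℝ) ∧
      (a.P ω).toReal * (a.y ω : ℝ) ≤ (a.P ω).toReal := by
    intro ω
    by_cases hP : a.P ω = 0
    · simp [hP]
    · exact ⟨mul_nonneg ENNReal.toReal_nonneg (ha ω hP).1,
        mul_le_of_le_one_right ENNReal.toReal_nonneg (ha ω hP).2⟩
  refine ⟨Finset.sum_nonneg fun ω _ => (h ω).1, ?_⟩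
  rw [← a.sum_toReal_P]
  exact Finset.sum_le_sum fun ω _ => (h ω).2

variable {n : ℕ} (arm : Fin n → Arm e₀)

/-- The gap between the best mean and the mean of the arm `i`. -/
def gap (i : Fin n) : ℝ := (⨆ j, (arm j).mean) - (arm i).mean

theorem gap_nonneg (i : Fin n) : 0 ≤ gap arm i :=
  sub_nonneg.mpr (le_ciSup (f := fun j => (arm j).mean) (Set.finite_range _).bddAbove i)

theorem exists_gap_eq_zero (i : Fin n) : ∃ i₀, gap arm i₀ = 0 := by
  have : Nonempty (Fin n) := ⟨i⟩
  obtain ⟨i₀, h⟩ := exists_eq_ciSup_of_finite (f := fun j => (arm j).mean)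
  exact ⟨i₀, by rw [gap, ← h, sub_self]⟩

theorem gap_eq_mean_sub {i₀ : Fin n} (h : gap arm i₀ = 0) (i : Fin n) :
    gap arm i = (arm i₀).mean - (arm i).mean := by
  unfold gap at *
  linarith

variable {arm}

theorem gap_le_one (ha : ∀ i, (arm i).BoundedValue) (i : Fin n) : gap arm i ≤ 1 := by
  obtain ⟨i₀, h⟩ := exists_gap_eq_zero arm i
  rw [gap_eq_mean_sub arm h]
  linarith [((arm i₀).mean_mem_Icc (ha i₀)).2, ((arm i).mean_mem_Icc (ha i)).1]

theorem regret_eq_sum_count (l : List (Fin n)) :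
    regret arm l = ∑ i, (l.count i : ℝ) * gap arm i := by
  have h : regret arm l = (l.map (gap arm)).sum := rfl
  rw [h, Finset.sum_list_map_count]
  simp only [nsmul_eq_mul]
  refine Finset.sum_subset (Finset.subset_univ _) fun i _ hi => ?_
  rw [List.count_eq_zero.mpr (by simpa using hi), Nat.cast_zero, zero_mul]

theorem regret_take_le (T : ℕ) (l : List (Fin n)) : regret arm (l.take T) ≤ regret arm l := by
  rw [regret_eq_sum_count, regret_eq_sum_count]
  refine Finset.sum_le_sum fun i _ => mul_le_mul_of_nonneg_right ?_ (gap_nonneg arm i)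
  exact_mod_cast (List.take_sublist T l).count_le i

theorem regret_le_length (ha : ∀ i, (arm i).BoundedValue) (l : List (Fin n)) :
    regret arm l ≤ l.length := by
  have h : regret arm l = (l.map (gap arm)).sum := rfl
  rw [h]
  have h2 := List.sum_le_card_nsmul (l.map (gap arm)) 1 (by
    intro x hx
    obtain ⟨i, _, rfl⟩ := List.mem_map.mp hx
    exact gap_le_one ha i)
  simpa using h2

theorem regret_take_le_nat (ha : ∀ i, (arm i).BoundedValue) (T : ℕ) (l : List (Fin n)) :
    regret arm (l.take T) ≤ T := by
  refine (regret_le_length ha _).trans ?_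
  exact_mod_cast List.length_take_le T l

end Gap

/-! ### Bookkeeping along a run -/

section Run

variable {Ω : Type} [Fintype Ω] [DecidableEq Ω] {V : Finset ℝ} {e₀ : Ω × V} {n : ℕ}
  (C₁ δ : ℝ) (arm : Fin n → Arm e₀)

/-- The plays and the radii of `s` are those after `m i` stages of each arm `i`, and each arm was
selected only while its gap was below twice its radius. -/
structure Consistent (m : Fin n → ℕ) (s : State n) : Prop where
  count_eq : ∀ i, s.played.count i =
    ∑ j ∈ Finset.range (m i), stageLength C₁ δ ((1 / 2) ^ j)
  radius_eq : ∀ i, s.radius i = (1 / 2) ^ (m i - 1)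
  gap_le : ∀ i, gap arm i ≤ 4 * s.radius i

/-- All estimates made so far are within their confidence radius. -/
def Accurate (m : Fin n → ℕ) (s : State n) : Prop :=
  ∀ i, m i ≠ 0 → |s.est i - (arm i).mean| < s.radius i

/-- The state after a stage of arm `i` with radius `r` and outcome `z`. -/
def State.next (s : State n) (i : Fin n) (r z : ℝ) : State n where
  radius := Function.update s.radius i r
  est := Function.update s.est i z
  played := s.played ++ List.replicate (stageLength C₁ δ r) i

variable {C₁ δ arm}

theorem consistent_start (ha : ∀ i, (arm i).BoundedValue) :
    Consistent C₁ δ arm 0 (State.start n) where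
  count_eq i := by simp [State.start]
  radius_eq i := by simp [State.start]
  gap_le i := by
    have := gap_le_one ha i
    simp only [State.start]
    linarith

/-- No accuracy of `z` is required: the outcome affects only later selections, so consistency
survives the first failed stage. -/
theorem Consistent.next {m : Fin n → ℕ} {s : State n} (h : Consistent C₁ δ arm m s) (i : Fin n)
    (hgap : gap arm i ≤ 4 * (1 / 2) ^ m i) (z : ℝ) :
    Consistent C₁ δ arm (Function.update m i (m i + 1)) (s.next C₁ δ i ((1 / 2) ^ m i) z) where
  count_eq j := by
    simp only [State.next, List.count_append, h.count_eq]
    by_cases hj : j = i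
    · subst hj
      simp [Finset.sum_range_succ]
    · simp [hj, List.count_replicate, Ne.symm hj]
  radius_eq j := by
    by_cases hj : j = i
    · subst hj; simp [State.next]
    · simp [State.next, hj, h.radius_eq]
  gap_le j := by
    by_cases hj : j = i
    · subst hj; simpa [State.next] using hgap
    · simpa [State.next, hj] using h.gap_le j

theorem Accurate.next {m : Fin n → ℕ} {s : State n} (h : Accurate arm m s) (i : Fin n) {r z : ℝ}
    (hz : |z - (arm i).mean| < r) :
    Accurate arm (Function.update m i (m i + 1)) (s.next C₁ δ i r z) := by
  intro j hj
  by_cases hji : j = i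
  · subst hji; simpa [State.next] using hz
  · simp only [State.next, Function.update_of_ne hji] at hj ⊢
    exact h j hj

/-! ### Stage lengths and the regret of a consistent run -/

theorem stageLength_le (hC : 0 ≤ C₁) (hδ : 0 ≤ Real.log (1 / δ)) (j : ℕ) :
    (stageLength C₁ δ ((1 / 2) ^ j) : ℝ) ≤ C₁ * Real.log (1 / δ) * 2 ^ j + 1 := by
  unfold stageLength
  refine (Nat.ceil_lt_add_one (by positivity)).le.trans_eq ?_
  rw [one_div_pow, div_div_eq_mul_div, div_one]
  ring

theorem le_stageLength (h : 1 ≤ C₁ * Real.log (1 / δ)) (j : ℕ) :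
    2 ^ j ≤ stageLength C₁ δ ((1 / 2) ^ j) := by
  unfold stageLength
  have h1 : (2 : ℝ) ^ j ≤ C₁ / (1 / 2) ^ j * Real.log (1 / δ) := by
    rw [one_div_pow, div_div_eq_mul_div, div_one, mul_right_comm]
    exact le_mul_of_one_le_left (by positivity) h
  exact_mod_cast h1.trans (Nat.le_ceil _)

/-- The stages of arm `i` alone take at least `1 + 2 + ... + 2 ^ (m i - 1) = 2 ^ m i - 1` rounds.
Thus at most `log₂ T` stages of an arm end before the horizon. -/
theorem Consistent.two_pow_le {m : Fin n → ℕ} {s : State n} (h : Consistent C₁ δ arm m s)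
    (hC : 1 ≤ C₁ * Real.log (1 / δ)) {T : ℕ} (hT : s.played.length < T) (i : Fin n) :
    2 ^ m i ≤ T := by
  have h1 : ∀ k, 2 ^ k ≤ ∑ j ∈ Finset.range k, stageLength C₁ δ ((1 / 2) ^ j) + 1 := by
    intro k
    induction k with
    | zero => simp
    | succ k ih =>
      rw [Finset.sum_range_succ, pow_succ]
      have := le_stageLength hC k
      omega
  have h3 := h1 (m i)
  rw [← h.count_eq] at h3
  have h2 : s.played.count i ≤ s.played.length := List.count_le_length
  omega

theorem eight_mul_le (m : ℕ) (hm : 3 ≤ m) : 8 * m ≤ 3 * 2 ^ m := by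
  induction m, hm using Nat.le_induction with
  | base => norm_num
  | succ m hm ih => rw [pow_succ]; omega

/-- The number of plays is of order `2 ^ m i` while the gap is at most `8 / 2 ^ m i`, so the
geometric growth cancels. The `3` pays for rounding up: `m i * gap ≤ 3`, by `gap ≤ 1` for `m i ≤ 3`
and by exponential decay beyond. -/
theorem Consistent.count_mul_gap_le {m : Fin n → ℕ} {s : State n} (h : Consistent C₁ δ arm m s)
    (ha : ∀ i, (arm i).BoundedValue) (hC : 0 ≤ C₁) (hδ : 0 ≤ Real.log (1 / δ)) (i : Fin n) :
    (s.played.count i : ℝ) * gap arm i ≤ 8 * C₁ * Real.log (1 / δ) + 3 := by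
  have hg0 := gap_nonneg arm i
  have hg1 := gap_le_one ha i
  have hCL : 0 ≤ C₁ * Real.log (1 / δ) := mul_nonneg hC hδ
  have h1 : (s.played.count i : ℝ) ≤ C₁ * Real.log (1 / δ) * 2 ^ m i + m i := by
    rw [h.count_eq]
    push_cast
    refine (Finset.sum_le_sum fun j _ => stageLength_le hC hδ j).trans ?_
    rw [Finset.sum_add_distrib, ← Finset.mul_sum, geom_sum_eq (by norm_num), Finset.sum_const,
      Finset.card_range, nsmul_eq_mul, mul_one, show (2 : ℝ) - 1 = 1 by norm_num, div_one]
    linarith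
  rcases Nat.eq_zero_or_pos (m i) with h0 | h0
  · have h2 : s.played.count i = 0 := by rw [h.count_eq, h0]; simp
    rw [h2]
    push_cast
    linarith
  have hg2 : gap arm i * 2 ^ m i ≤ 8 := by
    have h2 := h.gap_le i
    rw [h.radius_eq] at h2
    obtain ⟨k, hk⟩ := Nat.exists_eq_succ_of_ne_zero h0.ne'
    rw [hk, Nat.succ_sub_one, one_div_pow] at h2
    rw [hk, pow_succ]
    have h3 : (4 : ℝ) * (1 / 2 ^ k) * (2 ^ k * 2) = 8 := by field_simp; norm_num
    rw [← h3]
    exact mul_le_mul_of_nonneg_right h2 (by positivity)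
  have hm : (m i : ℝ) * gap arm i ≤ 3 := by
    rcases le_or_gt (m i) 3 with h3 | h3
    · have h4 : (m i : ℝ) ≤ 3 := by exact_mod_cast h3
      nlinarith
    · have h4 : (8 : ℝ) * m i ≤ 3 * 2 ^ m i := by exact_mod_cast eight_mul_le (m i) h3.le
      nlinarith
  calc (s.played.count i : ℝ) * gap arm i
      ≤ (C₁ * Real.log (1 / δ) * 2 ^ m i + m i) * gap arm i := mul_le_mul_of_nonneg_right h1 hg0
    _ = C₁ * Real.log (1 / δ) * (gap arm i * 2 ^ m i) + m i * gap arm i := by ring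
    _ ≤ _ := by nlinarith

theorem Consistent.regret_le {m : Fin n → ℕ} {s : State n} (h : Consistent C₁ δ arm m s)
    (ha : ∀ i, (arm i).BoundedValue) (hC : 0 ≤ C₁) (hδ : 0 ≤ Real.log (1 / δ)) (i : Fin n) :
    regret arm s.played ≤ (n - 1) * (8 * C₁ * Real.log (1 / δ) + 3) := by
  obtain ⟨i₀, hi₀⟩ := exists_gap_eq_zero arm i
  rw [regret_eq_sum_count, ← Finset.sum_erase_add _ _ (Finset.mem_univ i₀), hi₀, mul_zero, add_zero]
  refine (Finset.sum_le_card_nsmul _ _ _ fun i _ => h.count_mul_gap_le ha hC hδ i).trans_eq ?_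
  rw [Finset.card_erase_of_mem (Finset.mem_univ _), nsmul_eq_mul, Finset.card_univ, Fintype.card_fin,
    Nat.cast_pred i.pos]

/-- The best mean lies below its own upper confidence bound, hence below that of `i`, which exceeds
the mean of `i` by less than two radii. -/
theorem gap_le_of_argmax {m : Fin n → ℕ} {s : State n} (hacc : Accurate arm m s)
    (hm : ∀ i, m i ≠ 0) {i : Fin n}
    (hi : ∀ j, s.est j + s.radius j ≤ s.est i + s.radius i) : gap arm i ≤ 2 * s.radius i := by
  obtain ⟨i₀, h₀⟩ := exists_gap_eq_zero arm i
  rw [gap_eq_mean_sub arm h₀]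
  have h1 := abs_lt.mp (hacc i₀ (hm i₀))
  have h2 := abs_lt.mp (hacc i (hm i))
  linarith [hi i₀]

end Run

/-! ### The value functions of the stages -/

section Value

variable {Ω : Type} [Fintype Ω] [DecidableEq Ω] {V : Finset ℝ} {e₀ : Ω × V} {n : ℕ}
  {C₁ : ℝ} {T : ℕ} {QMC : ℝ → ℝ → QueryAlgorithm (Ω × V)} {arm : Fin n → Arm e₀}

/-- After `m i` accurate stages of each arm `i`, this bounds the expected final regret when `D`
bounds the regret of the accurate runs: each of the stages to come costs at most one more unit. -/
def valueBound (T : ℕ) (D : ℝ) (m : Fin n → ℕ) : ℝ := D + ∑ i, (Real.logb 2 T - m i)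

theorem valueBound_update (D : ℝ) (m : Fin n → ℕ) (i : Fin n) :
    valueBound T D (Function.update m i (m i + 1)) = valueBound T D m - 1 := by
  have h : ∀ j, Real.logb 2 T - (Function.update m i (m i + 1) j : ℝ) =
      (Real.logb 2 T - m j) - if j = i then 1 else 0 := by
    intro j
    by_cases hj : j = i
    · subst hj; simp; ring
    · simp [hj]
  simp only [valueBound, h, Finset.sum_sub_distrib]
  simp
  ring

theorem Consistent.le_valueBound {δ : ℝ} {m : Fin n → ℕ} {s : State n}
    (h : Consistent C₁ δ arm m s) (hC : 1 ≤ C₁ * Real.log (1 / δ)) (hT : s.played.length < T)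
    (D : ℝ) : D ≤ valueBound T D m := by
  refine le_add_of_nonneg_right (Finset.sum_nonneg fun i _ => sub_nonneg.mpr ?_)
  have h1 := h.two_pow_le hC hT i
  rw [Real.le_logb_iff_rpow_le (by norm_num) (by exact_mod_cast (Nat.zero_le _).trans_lt hT),
    Real.rpow_natCast]
  exact_mod_cast h1

theorem stage_of_le {δ : ℝ} {i : Fin n} {r : ℝ} {s : State n} (h : T ≤ s.played.length) :
    stage C₁ δ T QMC arm i r s = PMF.pure s := if_pos h

theorem stage_of_lt {δ : ℝ} {i : Fin n} {r : ℝ} {s : State n} (h : s.played.length < T) :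
    stage C₁ δ T QMC arm i r s = ((QMC r δ).law e₀ (arm i).O).map fun z => s.next C₁ δ i r z :=
  if_neg (not_le.mpr h)

/-- One step of backward induction: failure has probability at most `1/T` and `F ≤ T`, so it costs
at most `1`, which is exactly the drop of `valueBound` after a stage. -/
theorem expect_stage_le (hQ : IsQMC C₁ e₀ QMC) (ha : ∀ i, (arm i).BoundedValue) (hT : 2 ≤ T)
    (hC : 1 ≤ C₁ * Real.log (1 / (1 / (T : ℝ)))) {D : ℝ} (hD : 0 ≤ D) {F : State n → ℝ≥0∞}
    (hFT : ∀ s, F s ≤ T)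
    (hdone : ∀ s m, Consistent C₁ (1 / (T : ℝ)) arm m s → T ≤ s.played.length →
      F s ≤ ENNReal.ofReal D)
    {m : Fin n → ℕ} {s : State n} {i : Fin n}
    (hgood : ∀ s', Consistent C₁ (1 / (T : ℝ)) arm (Function.update m i (m i + 1)) s' →
      Accurate arm (Function.update m i (m i + 1)) s' → s'.played.length < T →
      F s' ≤ ENNReal.ofReal (valueBound T D (Function.update m i (m i + 1))))
    (hs : Consistent C₁ (1 / (T : ℝ)) arm m s) (hacc : Accurate arm m s)
    (hlen : s.played.length < T) (hgap : gap arm i ≤ 4 * (1 / 2) ^ m i) :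
    expect (stage C₁ (1 / (T : ℝ)) T QMC arm i ((1 / 2) ^ m i) s) F ≤
      ENNReal.ofReal (valueBound T D m) := by
  have hTpos : (0 : ℝ) < T := by exact_mod_cast (by omega : 0 < T)
  have hT1 : (1 : ℝ) < T := by exact_mod_cast (by omega : 1 < T)
  rw [stage_of_lt hlen, expect_map]
  have hnext := hs.next i hgap
  -- The number of rounds played does not depend on the outcome, so `0` stands for any. If this
  -- stage reaches the horizon, `D` holds for every outcome and no failure is charged.
  by_cases hlen' : T ≤ (s.next C₁ (1 / (T : ℝ)) i ((1 / 2) ^ m i) 0).played.length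
  · refine expect_le _ fun z => (hdone _ _ (hnext z) hlen').trans ?_
    exact ENNReal.ofReal_le_ofReal (hs.le_valueBound hC hlen D)
  · rw [not_le] at hlen'
    have hbad := (hQ ((1 / 2) ^ m i) (1 / T) (by positivity) (by positivity)
      (by rw [div_lt_one hTpos]; exact hT1)).2 (arm i) (ha i)
    refine (expect_le_add _ {z | (1 / 2 : ℝ) ^ m i ≤ |z - (arm i).mean|} (c := T)
      (fun z => hFT _) (fun z hz => hgood _ (hnext z) (hacc.next i ?_) hlen')).trans ?_
    · simpa using hz
    · have h1 := (hnext 0).le_valueBound hC hlen' D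
      have h2 : ENNReal.ofReal (1 / T) * (T : ℝ≥0∞) = ENNReal.ofReal 1 := by
        rw [← ENNReal.ofReal_natCast T, ← ENNReal.ofReal_mul (by positivity),
          one_div_mul_cancel hTpos.ne']
      refine (add_le_add_right (mul_le_mul_left hbad _) _).trans_eq ?_
      rw [h2, ← ENNReal.ofReal_add (hD.trans h1) zero_le_one, valueBound_update, sub_add_cancel]

/-- The regret of the first `T` rounds of a run. -/
def finalRegret (arm : Fin n → Arm e₀) (T : ℕ) (s : State n) : ℝ≥0∞ :=
  ENNReal.ofReal (regret arm (s.played.take T))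

theorem finalRegret_le_nat (ha : ∀ i, (arm i).BoundedValue) (s : State n) :
    finalRegret arm T s ≤ T := by
  rw [← ENNReal.ofReal_natCast T]
  exact ENNReal.ofReal_le_ofReal (regret_take_le_nat ha T _)

theorem Consistent.finalRegret_le {δ D : ℝ} {m : Fin n → ℕ} {s : State n}
    (h : Consistent C₁ δ arm m s) (ha : ∀ i, (arm i).BoundedValue) (hC : 0 ≤ C₁)
    (hδ : 0 ≤ Real.log (1 / δ)) (i : Fin n)
    (hD : (n - 1) * (8 * C₁ * Real.log (1 / δ) + 3) ≤ D) :
    finalRegret arm T s ≤ ENNReal.ofReal D :=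
  ENNReal.ofReal_le_ofReal
    ((regret_take_le T _).trans ((h.regret_le ha hC hδ i).trans hD))

theorem mainStages_of_le {δ : ℝ} (sel : State n → Fin n) {s : State n}
    (h : T ≤ s.played.length) (k : ℕ) :
    mainStages C₁ δ T QMC arm sel k s = PMF.pure s := by
  induction k with
  | zero => rfl
  | succ k ih => rw [mainStages, stage_of_le h, PMF.pure_bind, ih]

theorem expect_mainStages_le (hQ : IsQMC C₁ e₀ QMC) (ha : ∀ i, (arm i).BoundedValue) (hT : 2 ≤ T)
    (hC₀ : 0 ≤ C₁) (hC : 1 ≤ C₁ * Real.log (1 / (1 / (T : ℝ))))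
    (hδ : 0 ≤ Real.log (1 / (1 / (T : ℝ)))) {D : ℝ} (hD₀ : 0 ≤ D)
    (hD : (n - 1) * (8 * C₁ * Real.log (1 / (1 / (T : ℝ))) + 3) ≤ D)
    {sel : State n → Fin n} (hsel : IsArgmaxRule sel) (k : ℕ) {m : Fin n → ℕ} {s : State n}
    (hs : Consistent C₁ (1 / (T : ℝ)) arm m s) (hacc : Accurate arm m s) (hm : ∀ i, m i ≠ 0)
    (hlen : s.played.length < T) :
    expect (mainStages C₁ (1 / (T : ℝ)) T QMC arm sel k s) (finalRegret arm T) ≤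
      ENNReal.ofReal (valueBound T D m) := by
  induction k generalizing m s with
  -- The bound also holds for a run cut off before round `T`, so it need not be shown here that `T`
  -- stages reach the horizon.
  | zero =>
    rw [mainStages, expect_pure]
    exact (hs.finalRegret_le ha hC₀ hδ (sel s) hD).trans
      (ENNReal.ofReal_le_ofReal (hs.le_valueBound hC hlen D))
  | succ k ih =>
    have hr : s.radius (sel s) / 2 = (1 / 2) ^ m (sel s) := by
      obtain ⟨j, hj⟩ := Nat.exists_eq_succ_of_ne_zero (hm (sel s))
      rw [hs.radius_eq, hj, Nat.succ_sub_one, Nat.succ_eq_add_one, pow_succ]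
      ring
    have hgap := gap_le_of_argmax hacc hm (hsel s)
    rw [mainStages, expect_bind, hr]
    refine expect_stage_le hQ ha hT hC hD₀ (fun s => expect_le _ (finalRegret_le_nat ha))
      (fun s' m' hs' hlen' => ?_) (fun s' hs' hacc' hlen' => ih hs' hacc' (fun j => ?_) hlen')
      hs hacc hlen (by rw [← hr]; linarith)
    · rw [mainStages_of_le sel hlen', expect_pure]
      exact hs'.finalRegret_le ha hC₀ hδ (sel s) hD
    · by_cases hj : j = sel s
      · subst hj; simp
      · simpa [hj] using hm j

/-- This turns the forward law into backward value functions, to which `expect_stage_le` applies one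
arm at a time. -/
theorem expect_foldl_stage {δ : ℝ} (l : List (Fin n)) (p : PMF (State n)) (F : State n → ℝ≥0∞) :
    expect (l.foldl (fun p i => p.bind (stage C₁ δ T QMC arm i 1)) p) F =
      expect p (l.foldr (fun i G s => expect (stage C₁ δ T QMC arm i 1 s) G) F) := by
  induction l generalizing p with
  | nil => rfl
  | cons i l ih => rw [List.foldl_cons, ih, expect_bind]; rfl

theorem expect_initStages_le (hQ : IsQMC C₁ e₀ QMC) (ha : ∀ i, (arm i).BoundedValue) (hT : 2 ≤ T)
    (hC : 1 ≤ C₁ * Real.log (1 / (1 / (T : ℝ)))) {D : ℝ} (hD : 0 ≤ D) {F : State n → ℝ≥0∞}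
    (hFT : ∀ s, F s ≤ T)
    (hdone : ∀ s m, Consistent C₁ (1 / (T : ℝ)) arm m s → T ≤ s.played.length →
      F s ≤ ENNReal.ofReal D)
    (hgood : ∀ s m, Consistent C₁ (1 / (T : ℝ)) arm m s → Accurate arm m s → (∀ i, m i ≠ 0) →
      s.played.length < T → F s ≤ ENNReal.ofReal (valueBound T D m)) :
    expect (initStages C₁ (1 / (T : ℝ)) T QMC arm) F ≤ ENNReal.ofReal (D + n * Real.logb 2 T) := by
  set G : List (Fin n) → State n → ℝ≥0∞ := fun l =>
    l.foldr (fun i G s => expect (stage C₁ (1 / (T : ℝ)) T QMC arm i 1 s) G) F with hG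
  have hGT : ∀ l s, G l s ≤ T := by
    intro l
    induction l with
    | nil => exact hFT
    | cons i l ih => exact fun s => expect_le _ ih
  have hGdone : ∀ l s m, Consistent C₁ (1 / (T : ℝ)) arm m s → T ≤ s.played.length →
      G l s ≤ ENNReal.ofReal D := by
    intro l
    induction l with
    | nil => exact hdone
    | cons i l ih =>
      intro s m hs hlen
      change expect (stage C₁ (1 / (T : ℝ)) T QMC arm i 1 s) (G l) ≤ _
      rw [stage_of_le hlen, expect_pure]
      exact ih s m hs hlen
  -- The list of pending arms consists exactly of those without a stage, so every pending radius `1`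
  -- equals `(1/2) ^ m i`.
  have hmain : ∀ l s m, l.Nodup → (∀ i, m i = 0 ↔ i ∈ l) →
      Consistent C₁ (1 / (T : ℝ)) arm m s → Accurate arm m s → s.played.length < T →
      G l s ≤ ENNReal.ofReal (valueBound T D m) := by
    intro l
    induction l with
    | nil =>
      intro s m _ hm hs hacc hlen
      exact hgood s m hs hacc (fun i => by simp [hm]) hlen
    | cons i l ih =>
      intro s m hl hm hs hacc hlen
      have hmi : m i = 0 := (hm i).mpr List.mem_cons_self
      rw [List.nodup_cons] at hl
      change expect (stage C₁ (1 / (T : ℝ)) T QMC arm i 1 s) (G l) ≤ _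
      have h1 : (1 : ℝ) = (1 / 2) ^ m i := by rw [hmi, pow_zero]
      have h2 := expect_stage_le (i := i) hQ ha hT hC hD (hGT l) (hGdone l)
        (fun s' hs' hacc' hlen' => ih s' _ hl.2 (fun j => ?_) hs' hacc' hlen') hs hacc hlen
        (by rw [← h1]; linarith [gap_le_one ha i])
      · rwa [← h1] at h2
      · by_cases hj : j = i
        · subst hj; simpa using hl.1
        · simp [hj, hm]
  have hfin := hmain (List.finRange n) (State.start n) 0 (List.nodup_finRange n) (fun i => by simp)
    (consistent_start ha) (fun i hi => absurd rfl hi) (by simp [State.start]; omega)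
  rw [initStages, expect_foldl_stage, expect_pure]
  refine hfin.trans_eq ?_
  simp [valueBound]

theorem expectedRegret_eq_expect {δ : ℝ} (sel : State n → Fin n) :
    expectedRegret C₁ δ T QMC arm sel = expect ((initStages C₁ δ T QMC arm).bind
      (mainStages C₁ δ T QMC arm sel T)) (finalRegret arm T) := by
  change expect (qucb C₁ δ T QMC arm sel) (fun l => ENNReal.ofReal (regret arm l)) = _
  rw [qucb, expect_map]
  rfl

/-- A bound for the expected regret that holds as soon as all stages with radius `r` take at least
`1 / r` rounds. -/
theorem expectedRegret_le_of_one_le (hQ : IsQMC C₁ e₀ QMC) (ha : ∀ i, (arm i).BoundedValue)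
    (hT : 2 ≤ T) (hC₀ : 0 ≤ C₁) (hC : 1 ≤ C₁ * Real.log T) {sel : State n → Fin n}
    (hsel : IsArgmaxRule sel) :
    expectedRegret C₁ (1 / (T : ℝ)) T QMC arm sel ≤
      ENNReal.ofReal ((n - 1) * (8 * C₁ * Real.log T + 3) + n * Real.logb 2 T) := by
  have hlog : Real.log (1 / (1 / (T : ℝ))) = Real.log T := by rw [one_div_one_div]
  have hlog0 : 0 ≤ Real.log T := Real.log_natCast_nonneg T
  -- A selection rule always returns an arm, which excludes `n = 0`.
  have i := sel (State.start n)
  have hn : (1 : ℝ) ≤ n := by exact_mod_cast i.pos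
  have hD₀ : 0 ≤ (n - 1) * (8 * C₁ * Real.log T + 3) :=
    mul_nonneg (by linarith) (by positivity)
  rw [← hlog] at hC hlog0
  rw [expectedRegret_eq_expect, expect_bind]
  refine expect_initStages_le hQ ha hT hC hD₀ (fun s => expect_le _ (finalRegret_le_nat ha))
    (fun s m hs hlen => ?_) (fun s m hs hacc hm hlen => ?_)
  · rw [mainStages_of_le sel hlen, expect_pure]
    exact hs.finalRegret_le ha hC₀ hlog0 i (by rw [hlog])
  · exact expect_mainStages_le hQ ha hT hC₀ hC hlog0 hD₀ (by rw [hlog]) hsel T hs hacc hm hlen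

theorem expectedRegret_le_nat {δ : ℝ} (ha : ∀ i, (arm i).BoundedValue) (sel : State n → Fin n) :
    expectedRegret C₁ δ T QMC arm sel ≤ T := by
  rw [expectedRegret_eq_expect]
  exact expect_le _ (finalRegret_le_nat ha)

theorem expectedRegret_eq_zero {δ : ℝ} (hn : n = 1) (sel : State n → Fin n) :
    expectedRegret C₁ δ T QMC arm sel = 0 := by
  rw [expectedRegret_eq_expect, ← nonpos_iff_eq_zero]
  refine expect_le _ fun s => ?_
  subst hn
  have h : regret arm (s.played.take T) = 0 := by
    rw [regret_eq_sum_count]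
    simp [gap]
  simp [finalRegret, h]

end Value

/-! ### Small horizons and the final constants -/

theorem le_eight_mul_logb {T : ℕ} (h2 : 2 ≤ T) (h32 : T < 32) : (T : ℝ) ≤ 8 * Real.logb 2 T := by
  have h : 2 ^ T ≤ T ^ 8 := by interval_cases T <;> norm_num
  have hT : (0 : ℝ) < T := by exact_mod_cast (by omega : 0 < T)
  have h3 : Real.logb 2 ((T : ℝ) ^ 8) = 8 * Real.logb 2 T := by
    rw [Real.logb_pow]; norm_num
  rw [← h3, Real.le_logb_iff_rpow_le (by norm_num) (by positivity), Real.rpow_natCast]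
  exact_mod_cast h

theorem expectedRegret_le {Ω : Type} [Fintype Ω] [DecidableEq Ω] {V : Finset ℝ} {e₀ : Ω × V}
    {n : ℕ} {C₁ : ℝ} {T : ℕ} {QMC : ℝ → ℝ → QueryAlgorithm (Ω × V)} {arm : Fin n → Arm e₀}
    (hC : 1 < C₁) (hQ : IsQMC C₁ e₀ QMC) (ha : ∀ i, (arm i).BoundedValue) (hT : 2 ≤ T)
    {sel : State n → Fin n} (hsel : IsArgmaxRule sel) :
    expectedRegret C₁ (1 / (T : ℝ)) T QMC arm sel ≤
      ENNReal.ofReal ((8 * ((n : ℝ) - 1) * C₁ + 1) * Real.logb 2 (T : ℝ)) := by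
  have hn : 0 < n := (sel (State.start n)).pos
  have hlog2 := Real.log_two_lt_d9
  have hlog2' := Real.log_two_gt_d9
  have hLL : Real.log T = Real.logb 2 T * Real.log 2 := by
    rw [Real.logb, div_mul_cancel₀ _ (by linarith)]
  rcases lt_or_ge T 32 with h | h
  · rcases Nat.lt_or_ge 1 n with h1 | h1
    · refine (expectedRegret_le_nat ha sel).trans ?_
      rw [← ENNReal.ofReal_natCast T]
      refine ENNReal.ofReal_le_ofReal ?_
      have h2 := le_eight_mul_logb hT h
      have hT0 : (0 : ℝ) ≤ T := Nat.cast_nonneg T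
      have h3 : (2 : ℝ) ≤ n := by exact_mod_cast h1
      have h4 : 8 ≤ 8 * ((n : ℝ) - 1) * C₁ + 1 := by nlinarith
      nlinarith
    · rw [expectedRegret_eq_zero (by omega)]
      exact zero_le
  · have hL : 5 ≤ Real.logb 2 T := by
      rw [Real.le_logb_iff_rpow_le (by norm_num) (by exact_mod_cast (by omega : 0 < T))]
      norm_num
      exact_mod_cast h
    have hlog : 1 ≤ Real.log T := by rw [hLL]; nlinarith
    refine (expectedRegret_le_of_one_le hQ ha hT (by linarith) (by nlinarith) hsel).trans
      (ENNReal.ofReal_le_ofReal ?_)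
    have hn1 : (0 : ℝ) ≤ n - 1 := sub_nonneg.mpr (by exact_mod_cast hn)
    -- Passing from `ln` to `log₂` frees at least `2.4 C₁ log₂ T`, which exceeds `3 + log₂ T`
    -- because `C₁ > 1` and `log₂ T ≥ 5`. The remaining `log₂ T`, from `n = (n - 1) + 1`, is the `+
    -- 1` of the bound.
    have h1 : 8 * C₁ * Real.log T + 3 + Real.logb 2 T ≤ 8 * C₁ * Real.logb 2 T := by
      have h2 : 8 * C₁ * Real.log T ≤ 8 * C₁ * Real.logb 2 T * 0.7 := by
        rw [hLL, ← mul_assoc]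
        exact mul_le_mul_of_nonneg_left (by linarith) (by nlinarith)
      nlinarith
    nlinarith [mul_le_mul_of_nonneg_left h1 hn1]

end QBandit

end

theorem corollary1 :
    (∃ C₁ : ℝ, 1 < C₁ ∧
      ∀ (Ω : Type) [Fintype Ω] [DecidableEq Ω] (V : Finset ℝ) (e₀ : Ω × V),
        ∃ QMC : ℝ → ℝ → QBandit.QueryAlgorithm (Ω × V), QBandit.IsQMC C₁ e₀ QMC) ∧
    (∀ C₁ : ℝ, 1 < C₁ → ∃ K : ℝ, 0 < K ∧
      ∀ (Ω : Type) [Fintype Ω] [DecidableEq Ω] (V : Finset ℝ) (e₀ : Ω × V)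
        (QMC : ℝ → ℝ → QBandit.QueryAlgorithm (Ω × V)), QBandit.IsQMC C₁ e₀ QMC →
      ∀ (n : ℕ) (arm : Fin n → QBandit.Arm e₀), (∀ i, (arm i).BoundedValue) →
      ∀ (sel : QBandit.State n → Fin n), QBandit.IsArgmaxRule sel →
      ∀ T : ℕ, 2 ≤ T →
        QBandit.expectedRegret C₁ (1 / (T : ℝ)) T QMC arm sel ≤
            ENNReal.ofReal ((8 * ((n : ℝ) - 1) * C₁ + 1) * Real.logb 2 (T : ℝ)) ∧
        QBandit.expectedRegret C₁ (1 / (T : ℝ)) T QMC arm sel ≤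
            ENNReal.ofReal (K * (n : ℝ) * Real.log (T : ℝ))) := by
  refine ⟨⟨120, by norm_num, fun Ω _ _ V e₀ => QBandit.exists_isQMC e₀⟩,
    -- This `K` works because `1 ≤ 8 C₁` gives `8(n - 1)C₁ + 1 ≤ 8 C₁ n`; the `ln 2` converts the
    -- logarithm.
    fun C₁ hC => ⟨8 * C₁ / Real.log 2, by have := Real.log_pos one_lt_two; positivity,
      fun Ω _ _ V e₀ QMC hQ n arm ha sel hsel T hT => ?_⟩⟩
  have h := QBandit.expectedRegret_le hC hQ ha hT hsel
  refine ⟨h, h.trans (ENNReal.ofReal_le_ofReal ?_)⟩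
  have h1 : 8 * C₁ / Real.log 2 * n * Real.log T = 8 * C₁ * n * Real.logb 2 T := by
    rw [Real.logb]; ring
  rw [h1]
  exact mul_le_mul_of_nonneg_right (by linarith)
    (Real.logb_nonneg (by norm_num) (by exact_mod_cast (by omega : 1 ≤ T)))
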